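/- Let $T>0$, $D=(0,1)$, let $\kappa\ge 1$ be an integer and let $\mu\in\mathbb R$ satisfy $(\kappa-1)^2\pi^2\le\mu<\kappa^2\pi^2$. There is a constant $\widetilde C>0$, depending only on $T$ and $\mu$, such that the following holds. Let $W$ be a white noise on $[0,T]\times D$ on a probability space $(\Omega,\mathcal F,P)$, i.e. a centred Gaussian process indexed by the Borel sets $A\subset[0,T]\times D$ with $\mathbb E[W(A)W(B)]=|A\cap B|$. With $\lambda_k=k\pi$ and $\varepsilon_k(z)=\sqrt2\,\sin(\lambda_kz)$ put $$\Psi(t;x,y)=-\sum_{k=1}^\infty e^{-\lambda_k^2(\lambda_k^2-\mu)t}\,\varepsilon_k(x)\,\varepsilon_k'(y),\qquad t>0.$$ Let $u$ be the mild solution of $\partial_tu+\partial_x^4u+\mu\,\partial_x^2u=\partial_x\dot W$ in $(0,T]\times D$, $u=\partial_x^2u=0$ on $\partial D$, $u(0,\cdot)=0$, that is, a measurable random field with $$u(t,x)=\int_0^t\!\!\int_D\Psi(t-s;x,y)\,dW(s,y)\quad\text{a.s., for all } t\in[0,T],\ x\in D.$$ Let $N_\star,J_\star\ge1$ be integers,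 $\Delta t=T/N_\star$, $\Delta x=1/J_\star$, $T_n=((n-1)\Delta t,n\Delta t)$ for $n=1,\dots,N_\star$, and let $\psi_i(x)=\max\{0,\,1-|x-(i-1)\Delta x|/\Delta x\}$, $i=1,\dots,J_\star+1$, be the hat functions of the uniform partition of $[0,1]$. Let $G_{i,j}=\int_D\psi_j\psi_i\,dx$, $R_{n,i}=\int_{T_n}\int_D\psi_i(x)\,dW(t,x)$ and $$\widehat W(t,x)=\frac1{\Delta t}\sum_{n=1}^{N_\star}\mathbf 1_{T_n}(t)\sum_{\ell=1}^{J_\star+1}\Big(\sum_{m=1}^{J_\star+1}(G^{-1})_{\ell,m}R_{n,m}\Big)\psi_\ell(x).$$ Let $\widehat u$ be the solution of the regularized problem $\partial_t\widehat u+\partial_x^4\widehat u+\mu\,\partial_x^2\widehat u=\partial_x\widehat W$ in $(0,T]\times D$, $\widehat u=\partial_x^2\widehat u=0$ on $\partial D$, $\widehat u(0,\cdot)=0$, that is, a measurable random field such that for almost every $\omega$ one has $\widehat u(t,\cdot)\in L^2(D)$ for all $t\in[0,T]$ and, for every smooth $\varphi$ with $\varphi=\varphi''=0$ on $\partial D$,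 the function $s\mapsto\int_D\widehat u(s,x)(\varphi''''+\mu\varphi'')(x)\,dx$ is integrable on $[0,T]$ and $$\int_D\widehat u(t,x)\varphi(x)\,dx+\int_0^t\!\!\int_D\widehat u(s,x)\,(\varphi''''+\mu\,\varphi'')(x)\,dx\,ds=-\int_0^t\!\!\int_D\widehat W(s,x)\,\varphi'(x)\,dx\,ds\qquad\text{for all } t\in[0,T].$$ Then, for every $\epsilon\in(0,\tfrac12]$, $$\big(\mathbb E\big[\|u(t,\cdot)-\widehat u(t,\cdot)\|_{L^2(D)}^2\big]\big)^{1/2}\le\widetilde C\,\Big[\omega_0(\Delta t)\,\Delta t^{1/8}+\epsilon^{-1/2}\,\Delta x^{1/2-\epsilon}\Big]\qquad\text{for all } t\in[0,T],$$ where $\omega_0(\Delta t)=\sqrt{1+\Delta t^{3/4}}$. -/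

import Mathlib

open MeasureTheory ProbabilityTheory Set
open scoped ENNReal

noncomputable section

namespace CHC

/-! ### White noise and the stochastic integral of deterministic functions -/

/-- `W` is a white noise based on the measure `ν`: a centred Gaussian process indexed by the
measurable sets of finite `ν`-measure, with covariance `E[W(A) W(B)] = ν (A ∩ B)`. -/
structure IsWhiteNoise {Ω E : Type*} [MeasurableSpace Ω] [MeasurableSpace E]
    (P : Measure Ω) (ν : Measure E) (W : Set E → Ω → ℝ) : Prop where
  gaussian : IsGaussianProcess
    (fun A : {A : Set E // MeasurableSet A ∧ ν A ≠ ∞} => W (A : Set E)) P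
  mean_zero : ∀ A : Set E, MeasurableSet A → ν A ≠ ∞ → ∫ ω, W A ω ∂P = 0
  covariance : ∀ A B : Set E, MeasurableSet A → ν A ≠ ∞ → MeasurableSet B → ν B ≠ ∞ →
    ∫ ω, W A ω * W B ω ∂P = ν.real (A ∩ B)

/-- `X` is (a version of) the stochastic integral `∫ g dW` of the deterministic function
`g ∈ L²(ν)`: the pair `(g, X)` is a limit in `L²(ν) × L²(P)` of pairs
`(∑ cᵢ 1_{Aᵢ}, ∑ cᵢ W(Aᵢ))`, i.e. of step functions and their elementary integrals. -/
def IsStochIntegral {Ω E : Type*} [MeasurableSpace Ω] [MeasurableSpace E]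
    (P : Measure Ω) (ν : Measure E) (W : Set E → Ω → ℝ) (g : E → ℝ) (X : Ω → ℝ) : Prop :=
  MemLp g 2 ν ∧ MemLp X 2 P ∧
  ∀ δ : ℝ, 0 < δ → ∃ (n : ℕ) (c : Fin n → ℝ) (A : Fin n → Set E),
    (∀ i, MeasurableSet (A i) ∧ ν (A i) ≠ ∞) ∧
    eLpNorm (fun z => g z - ∑ i, c i * (A i).indicator (fun _ => (1 : ℝ)) z) 2 ν
      ≤ ENNReal.ofReal δ ∧
    eLpNorm (fun ω => X ω - ∑ i, c i * W (A i) ω) 2 P ≤ ENNReal.ofReal δ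

/-- The spatial domain `D = (0,1)`. -/
def D : Set ℝ := Ioo 0 1

/-- Lebesgue measure on `[0,T] × D`. -/
def spaceTime (T : ℝ) : Measure (ℝ × ℝ) := volume.restrict (Icc 0 T ×ˢ D)

/-! ### The mild solution -/

/-- `λ_k = k π`. -/
def lam (k : ℕ) : ℝ := k * Real.pi

/-- `ε_k(z) = √2 sin(λ_k z)`. -/
def eps (k : ℕ) (z : ℝ) : ℝ := √2 * Real.sin (lam k * z)

/-- `Ψ(t;x,y) = - ∑_{k ≥ 1} exp(-λ_k² (λ_k² - μ) t) ε_k(x) ε_k'(y)` (used for `t > 0` only, where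
the series converges absolutely). -/
def Psi (μ t x y : ℝ) : ℝ :=
  -∑' j : ℕ, Real.exp (-(lam (j + 1) ^ 2 * (lam (j + 1) ^ 2 - μ) * t)) *
    eps (j + 1) x * deriv (eps (j + 1)) y

/-- `u` is (a version of) the mild solution of
`∂ₜu + ∂ₓ⁴u + μ ∂ₓ²u = ∂ₓẆ`, `u = ∂ₓ²u = 0` on `∂D`, `u(0,·) = 0`:
a measurable random field with `u(t,x) = ∫₀ᵗ ∫_D Ψ(t-s;x,y) dW(s,y)` almost surely. -/
structure IsMildSolution {Ω : Type*} [MeasurableSpace Ω] (P : Measure Ω) (T μ : ℝ)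
    (W : Set (ℝ × ℝ) → Ω → ℝ) (u : ℝ → ℝ → Ω → ℝ) : Prop where
  measurable : ∀ t ∈ Icc 0 T,
    AEStronglyMeasurable (fun p : ℝ × Ω => u t p.1 p.2) ((volume.restrict D).prod P)
  eq_integral : ∀ t ∈ Icc 0 T, ∀ x ∈ D,
    IsStochIntegral P (spaceTime T) W
      (fun p => (Ioo 0 t).indicator (fun s => Psi μ (t - s) x p.2) p.1) (u t x)

/-! ### The regularized problem -/

/-- The hat function of the uniform partition of `[0,1]` with `J` cells which belongs to the node
`x_i = i / J`, `i = 0, …, J`. -/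
def hat (J : ℕ) (i : Fin (J + 1)) (x : ℝ) : ℝ := max 0 (1 - |x - (i : ℝ) / J| * J)

/-- The Gram matrix of the hat functions in `L²(D)`. -/
def gram (J : ℕ) : Matrix (Fin (J + 1)) (Fin (J + 1)) ℝ :=
  Matrix.of fun i j => ∫ x in D, hat J j x * hat J i x

/-- The open time cell `(n Δt, (n+1) Δt)`, `Δt = T / N`, `n = 0, …, N - 1`. -/
def timeCell (T : ℝ) (N : ℕ) (n : Fin N) : Set ℝ :=
  Ioo ((n : ℝ) * (T / N)) (((n : ℝ) + 1) * (T / N))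

/-- `R n i` is (a version of) `∫_{T_n} ∫_D ψ_i(x) dW(t,x)`. -/
def IsNoiseCoefficients {Ω : Type*} [MeasurableSpace Ω] (P : Measure Ω) (T : ℝ)
    (W : Set (ℝ × ℝ) → Ω → ℝ) (N J : ℕ) (R : Fin N → Fin (J + 1) → Ω → ℝ) : Prop :=
  ∀ n i, IsStochIntegral P (spaceTime T) W
    (fun p => (timeCell T N n).indicator (fun _ => hat J i p.2) p.1) (R n i)

/-- The regularized noise
`Ŵ(t,x) = (1/Δt) ∑ₙ 1_{Tₙ}(t) ∑_ℓ (∑ₘ (G⁻¹)_{ℓ,m} R_{n,m}) ψ_ℓ(x)`. -/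
def regNoise {Ω : Type*} (T : ℝ) (N J : ℕ) (R : Fin N → Fin (J + 1) → Ω → ℝ)
    (t x : ℝ) (ω : Ω) : ℝ :=
  (T / N)⁻¹ * ∑ n : Fin N, (timeCell T N n).indicator (fun _ =>
    ∑ l : Fin (J + 1), (∑ m : Fin (J + 1), (gram J)⁻¹ l m * R n m ω) * hat J l x) t

/-- Smooth test functions satisfying the boundary conditions `φ = φ'' = 0` on `∂D`. -/
structure IsTestFunction (φ : ℝ → ℝ) : Prop where
  smooth : ContDiff ℝ ((⊤ : ℕ∞) : WithTop ℕ∞) φ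
  zero_left : φ 0 = 0
  zero_right : φ 1 = 0
  second_left : iteratedDeriv 2 φ 0 = 0
  second_right : iteratedDeriv 2 φ 1 = 0

/-- `v : [0,T] × D → ℝ` is a weak solution of
`∂ₜv + ∂ₓ⁴v + μ ∂ₓ²v = ∂ₓf` in `(0,T] × D`, `v = ∂ₓ²v = 0` on `∂D`, `v(0,·) = 0`:
the equation is integrated in time from `0` to `t` and tested with `φ`, all space derivatives being
moved to `φ`. The boundary terms vanish because both `v` and `φ` satisfy the boundary conditions,
and the initial condition is the case `t = 0`. -/
structure IsWeakSolution (T μ : ℝ) (f v : ℝ → ℝ → ℝ) : Prop where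
  memLp : ∀ t ∈ Icc 0 T, MemLp (v t) 2 (volume.restrict D)
  integrable : ∀ φ, IsTestFunction φ → IntervalIntegrable
    (fun s => ∫ x in D, v s x * (iteratedDeriv 4 φ x + μ * iteratedDeriv 2 φ x)) volume 0 T
  weak_eq : ∀ φ, IsTestFunction φ → ∀ t ∈ Icc 0 T,
    (∫ x in D, v t x * φ x)
      + (∫ s in (0 : ℝ)..t, ∫ x in D, v s x * (iteratedDeriv 4 φ x + μ * iteratedDeriv 2 φ x))
      = -∫ s in (0 : ℝ)..t, ∫ x in D, f s x * deriv φ x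

/-- `v` is a solution of the regularized problem
`∂ₜv + ∂ₓ⁴v + μ ∂ₓ²v = ∂ₓŴ`, `v = ∂ₓ²v = 0` on `∂D`, `v(0,·) = 0`:
a measurable random field, almost every path of which is a weak solution. -/
structure IsRegularizedSolution {Ω : Type*} [MeasurableSpace Ω] (P : Measure Ω) (T μ : ℝ)
    (N J : ℕ) (R : Fin N → Fin (J + 1) → Ω → ℝ) (v : ℝ → ℝ → Ω → ℝ) : Prop where
  measurable : ∀ t ∈ Icc 0 T,
    AEStronglyMeasurable (fun p : ℝ × Ω => v t p.1 p.2) ((volume.restrict D).prod P)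
  weak : ∀ᵐ ω ∂P,
    IsWeakSolution T μ (fun t x => regNoise T N J R t x ω) (fun t x => v t x ω)

/-! ### The error -/

/-- `(E ‖u(t,·) - v(t,·)‖²_{L²(D)})^{1/2}`, with values in `[0,∞]`. -/
def rmsError {Ω : Type*} [MeasurableSpace Ω] (P : Measure Ω)
    (u v : ℝ → ℝ → Ω → ℝ) (t : ℝ) : ℝ≥0∞ :=
  (∫⁻ ω, eLpNorm (fun x => u t x ω - v t x ω) 2 (volume.restrict D) ^ 2 ∂P) ^ (1 / 2 : ℝ)

/-- `ω₀(r) = √(1 + r^{3/4})`. -/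
def omega0 (r : ℝ) : ℝ := √(1 + r ^ (3 / 4 : ℝ))

end CHC

end

/-!
Everything is expanded in the sine basis `ε_k` of `L²(D)`. The `k`-th Fourier coefficient of the mild
solution `u(t,·)` should be the stochastic integral of `-f_k`, where
`f_k(s,y) = 1_{(0,t)}(s) exp(-a_k (t - s)) ε_k'(y)` and `a_k = λ_k² (λ_k² - μ)`. Testing the weak
formulation of the regularized problem with `ε_k` gives a scalar equation `y' + a_k y = -h` with a
step function `h` (`duhamel`); its solution shows that the `k`-th coefficient of `v(t,·)` is the
stochastic integral of `-(p_k ⊗ q_k)`, where `p_k ⊗ q_k` is the `L²`-orthogonal projection of `f_k`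
onto products of step functions in time and hat functions in space (`integral_mul_eps_eq_regCoef`,
`isStochIntegral_regCoef`). Hence the mean square error is at most the sum over `k` of the squared
projection errors.

Stochastic Fourier coefficients of `u` are never formed. Instead, `v` is truncated to its first `K`
modes: for fixed `x`, the difference of `u(t,x)` and the truncation is a stochastic integral, whose
second moment is controlled by the `L²` norm of its integrand. Integrating over `x` with Parseval's
identity and Fatou's lemma gives the projection errors of the first `K` modes plus the energy
`∑_{k > K} ‖f_k‖²` of the remaining ones (`lintegral_mildKernel_sub_le`). By completeness of the sine
system (`tendsto_eLpNorm_sine_expansion`) and Fatou's lemma in `ω`, one may let `K → ∞`.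

The projection error of a tensor product splits into a temporal and a spatial part
(`integral_prod_sub_sq_le`). As `‖1_{(0,t)} exp(-a_k (t - ·))‖² ≤ C λ_k⁻⁴`, the spatial part is at
most `C min(k⁻², J⁻²)`, and the temporal one at most `C min(k⁻², k² Δt)`. Summation over `k` gives
`C (Δx + Δt^{1/4})`, which is the claimed rate, even with `ε = 0` in the exponent of `Δx`.
-/

namespace CHC

/-! ### The stochastic integral of deterministic functions -/

section StochIntegral

lemma eLpNorm_two_sq {α : Type*} [MeasurableSpace α] (ν : Measure α) (f : α → ℝ) :
    eLpNorm f 2 ν ^ 2 = ∫⁻ z, ‖f z‖ₑ ^ 2 ∂ν := by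
  rw [eLpNorm_eq_lintegral_rpow_enorm_toReal (by norm_num) (by norm_num)]
  simp only [ENNReal.toReal_ofNat, ← ENNReal.rpow_natCast]
  rw [← ENNReal.rpow_mul]
  norm_num

lemma lintegral_enorm_sq_eq_ofReal {α : Type*} [MeasurableSpace α] {ν : Measure α} {f : α → ℝ}
    (hf : MemLp f 2 ν) : ∫⁻ z, ‖f z‖ₑ ^ 2 ∂ν = ENNReal.ofReal (∫ z, f z ^ 2 ∂ν) := by
  rw [ofReal_integral_eq_lintegral_ofReal hf.integrable_sq
    (Filter.Eventually.of_forall fun z => sq_nonneg _)]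
  refine lintegral_congr fun z => ?_
  rw [← ofReal_norm, ← ENNReal.ofReal_pow (norm_nonneg _), Real.norm_eq_abs, sq_abs]

lemma eLpNorm_two_eq_of_integral_sq_eq {α β : Type*} [MeasurableSpace α] [MeasurableSpace β]
    {ν : Measure α} {ρ : Measure β} {f : α → ℝ} {g : β → ℝ} (hf : MemLp f 2 ν) (hg : MemLp g 2 ρ)
    (h : ∫ z, f z ^ 2 ∂ν = ∫ z, g z ^ 2 ∂ρ) : eLpNorm f 2 ν = eLpNorm g 2 ρ := by
  refine (ENNReal.pow_right_strictMono two_ne_zero).injective ?_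
  simp only [eLpNorm_two_sq, lintegral_enorm_sq_eq_ofReal hf, lintegral_enorm_sq_eq_ofReal hg, h]

variable {Ω E : Type*} [MeasurableSpace Ω] [MeasurableSpace E] {P : Measure Ω} {ν : Measure E}
  {W : Set E → Ω → ℝ}

lemma IsWhiteNoise.memLp (hW : IsWhiteNoise P ν W) {A : Set E} (hA : MeasurableSet A)
    (hA' : ν A ≠ ∞) : MemLp (W A) 2 P :=
  (hW.gaussian.hasGaussianLaw_eval ⟨A, hA, hA'⟩).memLp_two

/-- Itô's isometry for step functions. -/
lemma IsWhiteNoise.eLpNorm_sum (hW : IsWhiteNoise P ν W) {n : ℕ} (c : Fin n → ℝ)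
    {A : Fin n → Set E} (hA : ∀ i, MeasurableSet (A i) ∧ ν (A i) ≠ ∞) :
    eLpNorm (fun ω => ∑ i, c i * W (A i) ω) 2 P =
      eLpNorm (fun z => ∑ i, c i * (A i).indicator (fun _ => (1 : ℝ)) z) 2 ν := by
  have h1 : ∀ i, MemLp (W (A i)) 2 P := fun i => hW.memLp (hA i).1 (hA i).2
  have h2 : ∀ i, MemLp ((A i).indicator (fun _ => (1 : ℝ))) 2 ν :=
    fun i => memLp_indicator_const 2 (hA i).1 1 (Or.inr (hA i).2)
  have i1 : ∀ i j, Integrable (fun ω => W (A i) ω * W (A j) ω) P :=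
    fun i j => (h1 i).integrable_mul (h1 j)
  have i2 : ∀ i j, Integrable (fun z => (A i).indicator (fun _ => (1 : ℝ)) z *
      (A j).indicator (fun _ => (1 : ℝ)) z) ν := fun i j => (h2 i).integrable_mul (h2 j)
  refine eLpNorm_two_eq_of_integral_sq_eq
    (memLp_finsetSum _ fun i _ => (h1 i).const_mul (c i))
    (memLp_finsetSum _ fun i _ => (h2 i).const_mul (c i)) ?_
  have e1 : ∀ ω, (∑ i, c i * W (A i) ω) ^ 2 =
      ∑ i, ∑ j, c i * c j * (W (A i) ω * W (A j) ω) := fun ω => by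
    rw [sq, Finset.sum_mul_sum]
    exact Finset.sum_congr rfl fun i _ => Finset.sum_congr rfl fun j _ => by ring
  have e2 : ∀ z, (∑ i, c i * (A i).indicator (fun _ => (1 : ℝ)) z) ^ 2 =
      ∑ i, ∑ j, c i * c j *
        ((A i).indicator (fun _ => (1 : ℝ)) z * (A j).indicator (fun _ => (1 : ℝ)) z) :=
    fun z => by
      rw [sq, Finset.sum_mul_sum]
      exact Finset.sum_congr rfl fun i _ => Finset.sum_congr rfl fun j _ => by ring
  simp only [e1, e2]
  rw [integral_finsetSum _ fun i _ => integrable_finsetSum _ fun j _ =>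
      (i1 i j).const_mul _,
    integral_finsetSum _ fun i _ => integrable_finsetSum _ fun j _ =>
      (i2 i j).const_mul _]
  refine Finset.sum_congr rfl fun i _ => ?_
  rw [integral_finsetSum _ fun j _ => (i1 i j).const_mul _,
    integral_finsetSum _ fun j _ => (i2 i j).const_mul _]
  refine Finset.sum_congr rfl fun j _ => ?_
  rw [integral_const_mul, integral_const_mul,
    hW.covariance _ _ (hA i).1 (hA i).2 (hA j).1 (hA j).2]
  congr 1
  rw [← integral_indicator_one ((hA i).1.inter (hA j).1)]
  refine integral_congr_ae (Filter.Eventually.of_forall fun z => ?_)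
  by_cases hi : z ∈ A i <;> by_cases hj : z ∈ A j <;> simp [hi, hj]

/-- The stochastic integral is a contraction from `L²(ν)` to `L²(P)`. -/
lemma IsStochIntegral.eLpNorm_le (hW : IsWhiteNoise P ν W) {g : E → ℝ} {X : Ω → ℝ}
    (h : IsStochIntegral P ν W g X) : eLpNorm X 2 P ≤ eLpNorm g 2 ν := by
  obtain ⟨hg, hX, happ⟩ := h
  refine ENNReal.le_of_forall_pos_le_add fun η hη _ => ?_
  obtain ⟨n, c, A, hA, h1, h2⟩ := happ (η / 2) (by positivity)
  have mS : MemLp (fun z => ∑ i, c i * (A i).indicator (fun _ => (1 : ℝ)) z) 2 ν :=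
    memLp_finsetSum _ fun i _ =>
      (memLp_indicator_const 2 (hA i).1 1 (Or.inr (hA i).2)).const_mul (c i)
  have mX : MemLp (fun ω => ∑ i, c i * W (A i) ω) 2 P :=
    memLp_finsetSum _ fun i _ => (hW.memLp (hA i).1 (hA i).2).const_mul (c i)
  have hη2 : ENNReal.ofReal ((η : ℝ) / 2) + ENNReal.ofReal ((η : ℝ) / 2) = η := by
    rw [← ENNReal.ofReal_add (by positivity) (by positivity), add_halves,
      ENNReal.ofReal_coe_nnreal]
  calc eLpNorm X 2 P
      = eLpNorm ((fun ω => X ω - ∑ i, c i * W (A i) ω) + fun ω => ∑ i, c i * W (A i) ω) 2 P := by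
        congr 1; ext ω; simp
    _ ≤ eLpNorm (fun ω => X ω - ∑ i, c i * W (A i) ω) 2 P
          + eLpNorm (fun ω => ∑ i, c i * W (A i) ω) 2 P :=
        eLpNorm_add_le (hX.sub mX).1 mX.1 (by norm_num)
    _ ≤ ENNReal.ofReal (η / 2)
          + eLpNorm (fun z => ∑ i, c i * (A i).indicator (fun _ => (1 : ℝ)) z) 2 ν := by
        rw [hW.eLpNorm_sum c hA]; gcongr
    _ = ENNReal.ofReal (η / 2)
          + eLpNorm (g - fun z => g z - ∑ i, c i * (A i).indicator (fun _ => (1 : ℝ)) z) 2 ν := by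
        congr 2; ext z; simp
    _ ≤ ENNReal.ofReal (η / 2) + (eLpNorm g 2 ν + ENNReal.ofReal (η / 2)) := by
        gcongr
        exact (eLpNorm_sub_le hg.1 (hg.sub mS).1 (by norm_num)).trans (add_le_add le_rfl h1)
    _ = eLpNorm g 2 ν + η := by rw [← hη2]; ring

lemma IsStochIntegral.zero : IsStochIntegral P ν W (fun _ => 0) (fun _ => 0) :=
  ⟨MemLp.zero, MemLp.zero, fun _ _ => ⟨0, Fin.elim0, Fin.elim0, fun i => i.elim0, by simp, by simp⟩⟩

/-- The stochastic integral is linear. -/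
lemma IsStochIntegral.add_const_mul (hW : IsWhiteNoise P ν W) {g h : E → ℝ} {X Y : Ω → ℝ}
    (hX : IsStochIntegral P ν W g X) (a : ℝ) (hY : IsStochIntegral P ν W h Y) :
    IsStochIntegral P ν W (fun z => g z + a * h z) (fun ω => X ω + a * Y ω) := by
  refine ⟨hX.1.add (hY.1.const_mul a), hX.2.1.add (hY.2.1.const_mul a), fun δ hδ => ?_⟩
  have hη : 0 < δ / 2 / (1 + |a|) := by positivity
  obtain ⟨n, c, A, hA, h1, h2⟩ := hX.2.2 (δ / 2) (by positivity)
  obtain ⟨m, d, B, hB, h3, h4⟩ := hY.2.2 _ hη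
  have haη : ‖a‖ₑ * ENNReal.ofReal (δ / 2 / (1 + |a|)) ≤ ENNReal.ofReal (δ / 2) := by
    rw [← ofReal_norm, Real.norm_eq_abs, ← ENNReal.ofReal_mul (abs_nonneg a)]
    refine ENNReal.ofReal_le_ofReal ?_
    rw [mul_div_assoc', div_le_iff₀ (by positivity)]
    nlinarith [abs_nonneg a]
  have hδ2 : ENNReal.ofReal (δ / 2) + ENNReal.ofReal (δ / 2) = ENNReal.ofReal δ := by
    rw [← ENNReal.ofReal_add (by positivity) (by positivity), add_halves]
  refine ⟨n + m, Fin.append c (fun i => a * d i), Fin.append A B, fun i => ?_, ?_, ?_⟩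
  · refine Fin.addCases (fun i => ?_) (fun i => ?_) i
    · simpa using hA i
    · simpa using hB i
  · have e : (fun z => g z + a * h z - ∑ i, Fin.append c (fun i => a * d i) i *
        (Fin.append A B i).indicator (fun _ => (1 : ℝ)) z) =
        (fun z => g z - ∑ i, c i * (A i).indicator (fun _ => (1 : ℝ)) z) +
        a • fun z => h z - ∑ i, d i * (B i).indicator (fun _ => (1 : ℝ)) z := by
      ext z
      simp only [Fin.sum_univ_add, Fin.append_left, Fin.append_right, Pi.add_apply, Pi.smul_apply,
        smul_eq_mul, mul_sub, Finset.mul_sum, mul_assoc]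
      ring
    have m1 : MemLp (fun z => ∑ i, c i * (A i).indicator (fun _ => (1 : ℝ)) z) 2 ν :=
      memLp_finsetSum _ fun i _ =>
        (memLp_indicator_const 2 (hA i).1 1 (Or.inr (hA i).2)).const_mul (c i)
    have m2 : MemLp (fun z => ∑ i, d i * (B i).indicator (fun _ => (1 : ℝ)) z) 2 ν :=
      memLp_finsetSum _ fun i _ =>
        (memLp_indicator_const 2 (hB i).1 1 (Or.inr (hB i).2)).const_mul (d i)
    rw [e, ← hδ2]
    refine (eLpNorm_add_le (hX.1.sub m1).1 ((hY.1.sub m2).const_smul a).1 (by norm_num)).trans ?_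
    rw [eLpNorm_const_smul]
    exact add_le_add h1 ((mul_le_mul_right h3 _).trans haη)
  · have e : (fun ω => X ω + a * Y ω - ∑ i, Fin.append c (fun i => a * d i) i *
        W (Fin.append A B i) ω) =
        (fun ω => X ω - ∑ i, c i * W (A i) ω) + a • fun ω => Y ω - ∑ i, d i * W (B i) ω := by
      ext z
      simp only [Fin.sum_univ_add, Fin.append_left, Fin.append_right, Pi.add_apply, Pi.smul_apply,
        smul_eq_mul, mul_sub, Finset.mul_sum, mul_assoc]
      ring
    have m1 : MemLp (fun ω => ∑ i, c i * W (A i) ω) 2 P :=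
      memLp_finsetSum _ fun i _ => (hW.memLp (hA i).1 (hA i).2).const_mul (c i)
    have m2 : MemLp (fun ω => ∑ i, d i * W (B i) ω) 2 P :=
      memLp_finsetSum _ fun i _ => (hW.memLp (hB i).1 (hB i).2).const_mul (d i)
    rw [e, ← hδ2]
    refine (eLpNorm_add_le (hX.2.1.sub m1).1 ((hY.2.1.sub m2).const_smul a).1
      (by norm_num)).trans ?_
    rw [eLpNorm_const_smul]
    exact add_le_add h2 ((mul_le_mul_right h4 _).trans haη)

lemma IsStochIntegral.sum (hW : IsWhiteNoise P ν W) {ι : Type*} (s : Finset ι) (c : ι → ℝ)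
    {g : ι → E → ℝ} {X : ι → Ω → ℝ} (h : ∀ i, IsStochIntegral P ν W (g i) (X i)) :
    IsStochIntegral P ν W (fun z => ∑ i ∈ s, c i * g i z) (fun ω => ∑ i ∈ s, c i * X i ω) := by
  classical
  induction s using Finset.induction_on with
  | empty => simpa using IsStochIntegral.zero
  | insert i s hi ih =>
    simp only [Finset.sum_insert hi, add_comm (c i * _)]
    exact ih.add_const_mul hW (c i) (h i)

end StochIntegral

/-! ### Orthonormality and completeness of the sine system -/

lemma continuous_eps (k : ℕ) : Continuous (eps k) := by unfold eps; fun_prop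

lemma hasDerivAt_eps (k : ℕ) (y : ℝ) :
    HasDerivAt (eps k) (√2 * lam k * Real.cos (lam k * y)) y := by
  have h := (((hasDerivAt_id y).const_mul (lam k)).sin).const_mul √2
  refine h.congr_deriv ?_
  simp only [id]; ring

lemma deriv_eps (k : ℕ) : deriv (eps k) = fun y => √2 * lam k * Real.cos (lam k * y) :=
  funext fun y => (hasDerivAt_eps k y).deriv

lemma continuous_deriv_eps (k : ℕ) : Continuous (deriv (eps k)) := by
  rw [deriv_eps]; fun_prop

lemma abs_eps_le (k : ℕ) (x : ℝ) : |eps k x| ≤ √2 := by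
  rw [eps, abs_mul, abs_of_nonneg (Real.sqrt_nonneg 2)]
  exact mul_le_of_le_one_right (Real.sqrt_nonneg 2) (Real.abs_sin_le_one _)

lemma lam_nonneg (k : ℕ) : 0 ≤ lam k := by unfold lam; positivity

lemma abs_deriv_eps_le (k : ℕ) (x : ℝ) : |deriv (eps k) x| ≤ √2 * lam k := by
  rw [deriv_eps, abs_mul, abs_mul, abs_of_nonneg (Real.sqrt_nonneg 2), abs_of_nonneg (lam_nonneg k)]
  exact mul_le_of_le_one_right (mul_nonneg (Real.sqrt_nonneg 2) (lam_nonneg k))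
    (Real.abs_cos_le_one _)

lemma lam_sin_eq_zero (k : ℕ) : Real.sin (lam k) = 0 := Real.sin_nat_mul_pi k

lemma integral_D_eq (f : ℝ → ℝ) : ∫ x in D, f x = ∫ x in (0 : ℝ)..1, f x := by
  rw [intervalIntegral.integral_of_le zero_le_one, D, integral_Ioc_eq_integral_Ioo]

instance isFiniteMeasure_D : IsFiniteMeasure (volume.restrict D) :=
  ⟨by simp [D]⟩

lemma memLp_D_of_continuous {f : ℝ → ℝ} (hf : Continuous f) (p : ℝ≥0∞) :
    MemLp f p (volume.restrict D) := by
  obtain ⟨C, hC⟩ := isCompact_Icc.exists_bound_of_continuousOn (s := Icc (0 : ℝ) 1) hf.continuousOn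
  refine MemLp.of_bound hf.aestronglyMeasurable C ?_
  filter_upwards [ae_restrict_mem (measurableSet_Ioo : MeasurableSet D)] with x hx
  exact hC x (Ioo_subset_Icc_self hx)

lemma integral_D_cos (m : ℤ) (hm : m ≠ 0) : ∫ x in D, Real.cos (m * Real.pi * x) = 0 := by
  have h : (m : ℝ) * Real.pi ≠ 0 := mul_ne_zero (by exact_mod_cast hm) Real.pi_ne_zero
  rw [integral_D_eq, intervalIntegral.integral_comp_mul_left (fun x => Real.cos x) h]
  simp [Real.sin_int_mul_pi]

/-- The functions `ε_k`, `k ≥ 1`, are orthonormal in `L²(D)`. -/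
lemma integral_eps_mul_eps (j k : ℕ) :
    ∫ x in D, eps (j + 1) x * eps (k + 1) x = if j = k then 1 else 0 := by
  have e : ∀ x, eps (j + 1) x * eps (k + 1) x =
      Real.cos (((j : ℤ) - k : ℤ) * Real.pi * x) - Real.cos (((j : ℤ) + k + 2 : ℤ) * Real.pi * x) := by
    intro x
    have e1 : (((j : ℤ) - k : ℤ) : ℝ) * Real.pi * x = lam (j + 1) * x - lam (k + 1) * x := by
      simp only [lam]; push_cast; ring
    have e2 : (((j : ℤ) + k + 2 : ℤ) : ℝ) * Real.pi * x = lam (j + 1) * x + lam (k + 1) * x := by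
      simp only [lam]; push_cast; ring
    rw [e1, e2, Real.cos_sub, Real.cos_add, eps, eps]
    linear_combination Real.sin (lam (j + 1) * x) * Real.sin (lam (k + 1) * x) *
      Real.mul_self_sqrt (zero_le_two (α := ℝ))
  have hi : ∀ m : ℤ, Integrable (fun x => Real.cos (m * Real.pi * x)) (volume.restrict D) :=
    fun m => (memLp_D_of_continuous (by fun_prop) 1).integrable le_rfl
  simp only [e]
  rw [integral_sub (hi _) (hi _), integral_D_cos ((j : ℤ) + k + 2) (by omega)]
  split_ifs with h
  · subst h
    simp [D]
  · rw [integral_D_cos _ (by omega), sub_zero]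

lemma integral_deriv_eps_sq (k : ℕ) : ∫ x in D, deriv (eps (k + 1)) x ^ 2 = lam (k + 1) ^ 2 := by
  have e : ∀ x, deriv (eps (k + 1)) x ^ 2 =
      lam (k + 1) ^ 2 * (1 + Real.cos ((2 * (k + 1) : ℤ) * Real.pi * x)) := by
    intro x
    have e1 : ((2 * (k + 1) : ℤ) : ℝ) * Real.pi * x = 2 * (lam (k + 1) * x) := by
      simp only [lam]; push_cast; ring
    rw [e1, Real.cos_two_mul, deriv_eps]
    linear_combination lam (k + 1) ^ 2 * Real.cos (lam (k + 1) * x) ^ 2 *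
      Real.mul_self_sqrt (zero_le_two (α := ℝ))
  simp only [e]
  rw [integral_const_mul, integral_add (integrable_const _)
    ((memLp_D_of_continuous (by fun_prop) 1).integrable le_rfl), integral_D_cos _ (by omega)]
  simp [D]

/-- Parseval's identity for finite sine sums. -/
lemma integral_sum_eps_sq (M : ℕ) (c : ℕ → ℝ) :
    ∫ x in D, (∑ j ∈ Finset.range M, c j * eps (j + 1) x) ^ 2 = ∑ j ∈ Finset.range M, c j ^ 2 := by
  have hi : ∀ j k, Integrable (fun x => c j * c k * (eps (j + 1) x * eps (k + 1) x))
      (volume.restrict D) := fun j k =>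
    (memLp_D_of_continuous (by have := continuous_eps; fun_prop) 1).integrable le_rfl
  have e : ∀ x, (∑ j ∈ Finset.range M, c j * eps (j + 1) x) ^ 2 =
      ∑ j ∈ Finset.range M, ∑ k ∈ Finset.range M,
        c j * c k * (eps (j + 1) x * eps (k + 1) x) := fun x => by
    rw [sq, Finset.sum_mul_sum]
    exact Finset.sum_congr rfl fun i _ => Finset.sum_congr rfl fun j _ => by ring
  simp only [e]
  rw [integral_finsetSum _ fun j _ => integrable_finsetSum _ fun k _ => hi j k]
  refine Finset.sum_congr rfl fun j hj => ?_
  rw [integral_finsetSum _ fun k _ => hi j k]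
  simp only [integral_const_mul, integral_eps_mul_eps, mul_ite, mul_one, mul_zero,
    Finset.sum_ite_eq, hj, if_true, sq]

/-- Multiplication by `cos (π x)` shifts the frequency of `ε_k` up and down by one. -/
lemma eps_mul_cos (k : ℕ) (x : ℝ) :
    eps (k + 1) x * Real.cos (Real.pi * x) = (eps (k + 2) x + eps k x) / 2 := by
  have e1 : lam (k + 2) * x = lam (k + 1) * x + Real.pi * x := by simp only [lam]; push_cast; ring
  have e2 : lam k * x = lam (k + 1) * x - Real.pi * x := by simp only [lam]; push_cast; ring
  simp only [eps]
  rw [e1, e2, Real.sin_add, Real.sin_sub]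
  ring

/-- A function orthogonal to all `ε_k` vanishes: being orthogonal to all `ε_1 · p(cos π x)` with
polynomials `p`, it is orthogonal to `ε_1 · g` for all continuous `g`. -/
lemma ae_eq_zero_of_integral_eps {f : ℝ → ℝ} (hf : Integrable f (volume.restrict D))
    (h : ∀ k, ∫ x in D, f x * eps (k + 1) x = 0) : f =ᵐ[volume.restrict D] 0 := by
  have hmeas : MeasurableSet D := measurableSet_Ioo
  have hbd : ∀ g : ℝ → ℝ, Continuous g → Integrable (fun x => f x * g x) (volume.restrict D) := by
    intro g hg
    obtain ⟨C, hC⟩ :=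
      isCompact_Icc.exists_bound_of_continuousOn (s := Icc (0 : ℝ) 1) hg.continuousOn
    refine hf.mul_bdd (c := C) hg.aestronglyMeasurable ?_
    filter_upwards [ae_restrict_mem hmeas] with x hx
    exact hC x (Ioo_subset_Icc_self hx)
  have h0 : ∀ k, ∫ x in D, f x * eps k x = 0 := by
    rintro (_ | k)
    · simp [eps, lam]
    · exact h k
  have hpow : ∀ n k, ∫ x in D, f x * (eps k x * Real.cos (Real.pi * x) ^ n) = 0 := by
    intro n
    induction n with
    | zero => simpa using h0
    | succ n ih =>
      rintro (_ | k)
      · simp [eps, lam]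
      · have e : ∀ x, f x * (eps (k + 1) x * Real.cos (Real.pi * x) ^ (n + 1)) =
            1 / 2 * (f x * (eps (k + 2) x * Real.cos (Real.pi * x) ^ n)) +
              1 / 2 * (f x * (eps k x * Real.cos (Real.pi * x) ^ n)) := fun x => by
          rw [pow_succ', ← mul_assoc (eps (k + 1) x), eps_mul_cos]; ring
        have hi : ∀ k, Integrable (fun x => 1 / 2 * (f x * (eps k x * Real.cos (Real.pi * x) ^ n)))
            (volume.restrict D) := fun k =>
          (hbd _ (by have := continuous_eps k; fun_prop)).const_mul _
        simp only [e]
        rw [integral_add (hi _) (hi _), integral_const_mul, integral_const_mul, ih, ih]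
        simp
  have hpoly : ∀ p : Polynomial ℝ,
      ∫ x in D, f x * (eps 1 x * p.eval (Real.cos (Real.pi * x))) = 0 := by
    intro p
    have hi : ∀ q : Polynomial ℝ, Integrable
        (fun x => f x * (eps 1 x * q.eval (Real.cos (Real.pi * x)))) (volume.restrict D) :=
      fun q => hbd _ (by have := continuous_eps 1; fun_prop)
    induction p using Polynomial.induction_on' with
    | add p q hp hq =>
      simp only [Polynomial.eval_add, mul_add]
      rw [integral_add (hi p) (hi q), hp, hq, add_zero]
    | monomial n a =>
      have e : ∀ x, f x * (eps 1 x * (Polynomial.monomial n a).eval (Real.cos (Real.pi * x))) =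
          a * (f x * (eps 1 x * Real.cos (Real.pi * x) ^ n)) := fun x => by
        rw [Polynomial.eval_monomial]; ring
      simp only [e]
      rw [integral_const_mul, hpow, mul_zero]
  have hcont : ∀ g : ℝ → ℝ, Continuous g → ∫ x in D, f x * (eps 1 x * g x) = 0 := by
    intro g hg
    have hce := continuous_eps 1
    set B := ∫ x in D, |f x * eps 1 x| with hB
    have hB0 : 0 ≤ B := integral_nonneg fun x => abs_nonneg _
    refine abs_nonpos_iff.1 (le_of_forall_pos_le_add fun δ hδ => ?_)
    obtain ⟨p, hp⟩ := exists_polynomial_near_of_continuousOn (-1) 1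
      (fun z => g (Real.arccos z / Real.pi))
      (hg.comp (Real.continuous_arccos.div_const _)).continuousOn (δ / (B + 1)) (by positivity)
    have hi1 : Integrable (fun x => f x * (eps 1 x * g x)) (volume.restrict D) :=
      hbd _ (hce.mul hg)
    have hi2 : Integrable (fun x => f x * (eps 1 x * p.eval (Real.cos (Real.pi * x))))
      (volume.restrict D) := hbd _ (by fun_prop)
    have e : ∫ x in D, f x * (eps 1 x * g x) =
        ∫ x in D, (f x * (eps 1 x * g x) - f x * (eps 1 x * p.eval (Real.cos (Real.pi * x)))) := by
      rw [integral_sub hi1 hi2, hpoly, sub_zero]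
    rw [e, zero_add]
    calc _ ≤ ∫ x in D, |f x * (eps 1 x * g x) -
              f x * (eps 1 x * p.eval (Real.cos (Real.pi * x)))| := abs_integral_le_integral_abs
      _ ≤ ∫ x in D, |f x * eps 1 x| * (δ / (B + 1)) := by
        refine integral_mono_ae (hi1.sub hi2).abs ((hbd _ hce).abs.mul_const _) ?_
        filter_upwards [ae_restrict_mem hmeas] with x hx
        have hx' : Real.pi * x ∈ Icc 0 Real.pi := by
          constructor
          · exact mul_nonneg Real.pi_pos.le hx.1.le
          · nlinarith [Real.pi_pos, hx.2]
        have := hp (Real.cos (Real.pi * x)) ⟨Real.neg_one_le_cos _, Real.cos_le_one _⟩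
        rw [Real.arccos_cos hx'.1 hx'.2, mul_div_cancel_left₀ _ Real.pi_ne_zero, abs_sub_comm] at this
        rw [← mul_assoc, ← mul_assoc, ← mul_sub, abs_mul]
        gcongr
      _ = B * (δ / (B + 1)) := by rw [integral_mul_const]
      _ ≤ δ := by
        rw [mul_div_assoc', div_le_iff₀ (by positivity)]
        nlinarith
  have hae := (isOpen_Ioo : IsOpen (Ioo (0 : ℝ) 1)).ae_eq_zero_of_integral_contDiff_smul_eq_zero
    (μ := volume) (f := fun x => f x * eps 1 x)
    (IntegrableOn.locallyIntegrableOn (hbd _ (continuous_eps 1))) fun g hg _ hgs => by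
      have := hcont g hg.continuous
      rw [← setIntegral_eq_integral_of_forall_compl_eq_zero (s := D), ← this]
      · exact integral_congr_ae (Filter.Eventually.of_forall fun x => by
          simp only [smul_eq_mul]; ring)
      · intro x hx
        rw [image_eq_zero_of_notMem_tsupport (fun h => hx (hgs h)), zero_smul]
  filter_upwards [ae_restrict_of_ae hae, ae_restrict_mem hmeas] with x hx hxD
  have hpos : 0 < eps 1 x := by
    have : lam 1 * x = Real.pi * x := by simp [lam]
    rw [eps, this]
    refine mul_pos (by positivity) (Real.sin_pos_of_pos_of_lt_pi
      (mul_pos Real.pi_pos hxD.1) ?_)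
    nlinarith [Real.pi_pos, hxD.2]
  exact (mul_eq_zero.1 (hx hxD)).resolve_right hpos.ne'

lemma memLp_eps (k : ℕ) : MemLp (eps k) 2 (volume.restrict D) :=
  memLp_D_of_continuous (continuous_eps k) 2

/-- The sine expansion of a function in `L²(D)` converges to it in `L²(D)`. -/
lemma tendsto_eLpNorm_sine_expansion {f : ℝ → ℝ} (hf : MemLp f 2 (volume.restrict D)) :
    Filter.Tendsto (fun K => eLpNorm (fun x => (∑ j ∈ Finset.range K,
      (∫ z in D, f z * eps (j + 1) z) * eps (j + 1) x) - f x) 2 (volume.restrict D))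
      Filter.atTop (nhds 0) := by
  let e : ℕ → Lp ℝ 2 (volume.restrict D) := fun j => (memLp_eps (j + 1)).toLp _
  have hinner : ∀ (g : Lp ℝ 2 (volume.restrict D)) j,
      inner ℝ (e j) g = ∫ z in D, g z * eps (j + 1) z := by
    intro g j
    rw [L2.inner_def]
    refine integral_congr_ae ?_
    filter_upwards [(memLp_eps (j + 1)).coeFn_toLp] with x hx
    simp [e, hx]
  have hon : Orthonormal ℝ e := by
    rw [orthonormal_iff_ite]
    intro i j
    rw [hinner, ← integral_eps_mul_eps i j]
    refine integral_congr_ae ?_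
    filter_upwards [(memLp_eps (j + 1)).coeFn_toLp] with x hx
    simp [e, hx, mul_comm]
  have hbot : (Submodule.span ℝ (Set.range e))ᗮ = ⊥ := by
    rw [Submodule.eq_bot_iff]
    intro g hg
    rw [Submodule.mem_orthogonal] at hg
    have hz : g =ᵐ[volume.restrict D] 0 :=
      ae_eq_zero_of_integral_eps ((Lp.memLp g).integrable (by norm_num)) fun k => by
        rw [← hinner]; exact hg _ (Submodule.subset_span ⟨k, rfl⟩)
    exact (Lp.eq_zero_iff_ae_eq_zero).2 hz
  have hs := ((HilbertBasis.mkOfOrthogonalEqBot hon hbot).hasSum_repr (hf.toLp f)).tendsto_sum_nat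
  rw [Lp.tendsto_Lp_iff_tendsto_eLpNorm _ f hf] at hs
  refine hs.congr fun K => eLpNorm_congr_ae ?_
  have hc : ∀ j, inner ℝ (e j) (hf.toLp f) = ∫ z in D, f z * eps (j + 1) z := by
    intro j
    rw [hinner]
    refine integral_congr_ae ?_
    filter_upwards [hf.coeFn_toLp] with x hx
    simp [hx]
  have hall : ∀ᵐ x ∂volume.restrict D, ∀ j,
      ((∫ z in D, f z * eps (j + 1) z) • e j : Lp ℝ 2 (volume.restrict D)) x =
        (∫ z in D, f z * eps (j + 1) z) * eps (j + 1) x := by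
    rw [ae_all_iff]
    intro j
    filter_upwards [Lp.coeFn_smul (∫ z in D, f z * eps (j + 1) z) (e j),
      (memLp_eps (j + 1)).coeFn_toLp] with x h1 h2
    rw [h1, Pi.smul_apply, smul_eq_mul]
    simp [e, h2]
  simp only [HilbertBasis.repr_apply_apply, HilbertBasis.coe_mkOfOrthogonalEqBot, hc]
  filter_upwards [Lp.coeFn_finsetSum (Finset.range K)
    fun j => (∫ z in D, f z * eps (j + 1) z) • e j, hall] with x h1 h2
  rw [Pi.sub_apply, h1, Finset.sum_apply]
  simp only [h2]

/-! ### Orthogonal projections in `L²` and their tensor products -/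

/-- An orthogonal projection `p` of `f` is a best approximation: `h` is any competitor such that
`p - h` is orthogonal to `f - p`. -/
lemma integral_sub_sq_le_of_orthogonal {α : Type*} [MeasurableSpace α] {ν : Measure α}
    {f p h : α → ℝ} (hf : MemLp f 2 ν) (hp : MemLp p 2 ν) (hh : MemLp h 2 ν)
    (h1 : ∫ z, (f z - p z) * p z ∂ν = 0) (h2 : ∫ z, (f z - p z) * h z ∂ν = 0) :
    ∫ z, (f z - p z) ^ 2 ∂ν ≤ ∫ z, (f z - h z) ^ 2 ∂ν := by
  have i0 : Integrable (fun z => (f z - p z) ^ 2) ν := (hf.sub hp).integrable_sq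
  have i1 : Integrable (fun z => (f z - p z) * p z) ν := (hf.sub hp).integrable_mul hp
  have i2 : Integrable (fun z => (f z - p z) * h z) ν := (hf.sub hp).integrable_mul hh
  have i3 : Integrable (fun z => (p z - h z) ^ 2) ν := (hp.sub hh).integrable_sq
  have i4 : Integrable (fun z => (f z - p z) ^ 2 + (p z - h z) ^ 2) ν := i0.add i3
  have i5 : Integrable (fun z => (f z - p z) * p z - (f z - p z) * h z) ν := i1.sub i2
  have e : ∀ z, (f z - h z) ^ 2 =
      ((f z - p z) ^ 2 + (p z - h z) ^ 2) + 2 * ((f z - p z) * p z - (f z - p z) * h z) :=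
    fun z => by ring
  simp only [e]
  rw [integral_add i4 (i5.const_mul 2), integral_add i0 i3, integral_const_mul,
    integral_sub i1 i2, h1, h2]
  have := integral_nonneg (μ := ν) (f := fun z => (p z - h z) ^ 2) fun z => sq_nonneg _
  linarith

lemma integral_sub_sq_eq_of_orthogonal {α : Type*} [MeasurableSpace α] {ν : Measure α}
    {f p : α → ℝ} (hf : MemLp f 2 ν) (hp : MemLp p 2 ν) (h : ∫ z, (f z - p z) * p z ∂ν = 0) :
    ∫ z, f z * p z ∂ν = ∫ z, p z ^ 2 ∂ν ∧
      ∫ z, (f z - p z) ^ 2 ∂ν = ∫ z, f z ^ 2 ∂ν - ∫ z, p z ^ 2 ∂ν := by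
  have i1 : Integrable (fun z => f z * p z) ν := hf.integrable_mul hp
  have i2 : Integrable (fun z => f z ^ 2 + p z ^ 2) ν := hf.integrable_sq.add hp.integrable_sq
  have e1 : ∫ z, f z * p z ∂ν = ∫ z, p z ^ 2 ∂ν := by
    have e : ∀ z, (f z - p z) * p z = f z * p z - p z ^ 2 := fun z => by ring
    simp only [e] at h
    rw [integral_sub i1 hp.integrable_sq] at h
    linarith
  refine ⟨e1, ?_⟩
  have e : ∀ z, (f z - p z) ^ 2 = (f z ^ 2 + p z ^ 2) - 2 * (f z * p z) := fun z => by ring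
  simp only [e]
  rw [integral_sub i2 (i1.const_mul 2), integral_add hf.integrable_sq hp.integrable_sq,
    integral_const_mul, e1]
  ring

/-- The error of a tensor product `p ⊗ q` of orthogonal projections. -/
lemma integral_prod_sub_sq_le {α β : Type*} [MeasurableSpace α] [MeasurableSpace β]
    {τ : Measure α} {σ : Measure β} [SFinite τ] [SFinite σ] {f p : α → ℝ} {g q : β → ℝ}
    (hf : MemLp f 2 τ) (hp : MemLp p 2 τ) (hg : MemLp g 2 σ) (hq : MemLp q 2 σ)
    (h1 : ∫ z, (f z - p z) * p z ∂τ = 0) (h2 : ∫ z, (g z - q z) * q z ∂σ = 0) :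
    ∫ z, (f z.1 * g z.2 - p z.1 * q z.2) ^ 2 ∂(τ.prod σ) ≤
      (∫ z, f z ^ 2 ∂τ) * (∫ z, (g z - q z) ^ 2 ∂σ)
        + (∫ z, g z ^ 2 ∂σ) * (∫ z, (f z - p z) ^ 2 ∂τ) := by
  obtain ⟨a1, a2⟩ := integral_sub_sq_eq_of_orthogonal hf hp h1
  obtain ⟨b1, b2⟩ := integral_sub_sq_eq_of_orthogonal hg hq h2
  have e : ∀ z : α × β, (f z.1 * g z.2 - p z.1 * q z.2) ^ 2 =
      f z.1 ^ 2 * g z.2 ^ 2 - 2 * ((f z.1 * p z.1) * (g z.2 * q z.2)) + p z.1 ^ 2 * q z.2 ^ 2 :=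
    fun z => by ring
  have i1 := hf.integrable_sq.mul_prod hg.integrable_sq
  have i2 : Integrable (fun z : α × β => (f z.1 * p z.1) * (g z.2 * q z.2)) (τ.prod σ) :=
    (hf.integrable_mul hp).mul_prod (hg.integrable_mul hq)
  have i3 := hp.integrable_sq.mul_prod hq.integrable_sq
  have i4 : Integrable (fun z : α × β => f z.1 ^ 2 * g z.2 ^ 2 -
      2 * ((f z.1 * p z.1) * (g z.2 * q z.2))) (τ.prod σ) := i1.sub (i2.const_mul 2)
  have e2 : ∫ z, (f z.1 * g z.2 - p z.1 * q z.2) ^ 2 ∂(τ.prod σ) =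
      (∫ z, f z ^ 2 ∂τ) * (∫ z, g z ^ 2 ∂σ) - (∫ z, p z ^ 2 ∂τ) * (∫ z, q z ^ 2 ∂σ) := by
    simp only [e]
    rw [integral_add i4 i3, integral_sub i1 (i2.const_mul 2),
      integral_const_mul, integral_prod_mul (fun z => f z ^ 2) (fun z => g z ^ 2),
      integral_prod_mul (fun z => f z * p z) (fun z => g z * q z),
      integral_prod_mul (fun z => p z ^ 2) (fun z => q z ^ 2), a1, b1]
    ring
  have ha : 0 ≤ ∫ z, (f z - p z) ^ 2 ∂τ := integral_nonneg fun z => sq_nonneg _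
  have hb : 0 ≤ ∫ z, (g z - q z) ^ 2 ∂σ := integral_nonneg fun z => sq_nonneg _
  rw [e2]
  have := mul_nonneg ha hb
  rw [a2, b2] at *
  nlinarith

/-! ### The projection onto the hat functions -/

lemma continuous_hat (J : ℕ) (i : Fin (J + 1)) : Continuous (hat J i) := by
  unfold hat; fun_prop

lemma memLp_hat (J : ℕ) (i : Fin (J + 1)) : MemLp (hat J i) 2 (volume.restrict D) :=
  memLp_D_of_continuous (continuous_hat J i) 2

lemma hat_nonneg (J : ℕ) (i : Fin (J + 1)) (x : ℝ) : 0 ≤ hat J i x := le_max_left _ _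

lemma hat_node {J : ℕ} (hJ : 1 ≤ J) (i j : Fin (J + 1)) :
    hat J i ((j : ℝ) / J) = if i = j then 1 else 0 := by
  have hJ' : (0 : ℝ) < J := by exact_mod_cast hJ
  have e : |(j : ℝ) / J - (i : ℝ) / J| * J = |(j : ℝ) - i| := by
    rw [← sub_div, abs_div, abs_of_pos hJ', div_mul_cancel₀ _ hJ'.ne']
  rw [hat, e]
  split_ifs with h
  · simp [h]
  · have h1 : (1 : ℤ) ≤ |(j : ℤ) - i| := Int.one_le_abs (by
      intro h2; apply h; ext; omega)
    have h2 : (1 : ℝ) ≤ |(j : ℝ) - i| := by exact_mod_cast h1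
    rw [max_eq_left (by linarith)]

lemma abs_sub_le_of_hat_ne_zero {J : ℕ} (hJ : 1 ≤ J) {i : Fin (J + 1)} {x : ℝ}
    (h : hat J i x ≠ 0) : |x - (i : ℝ) / J| ≤ 1 / J := by
  have hJ' : (0 : ℝ) < J := by exact_mod_cast hJ
  by_contra hc
  push Not at hc
  rw [div_lt_iff₀ hJ'] at hc
  exact h (max_eq_left (by linarith))

/-- The hat functions form a partition of unity on `[0,1]`. -/
lemma sum_hat {J : ℕ} (hJ : 1 ≤ J) {x : ℝ} (hx : x ∈ D) : ∑ i, hat J i x = 1 := by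
  have hJ' : (0 : ℝ) < J := by exact_mod_cast hJ
  have hxJ0 : 0 ≤ x * J := mul_nonneg hx.1.le hJ'.le
  have hval : ∀ i : Fin (J + 1), hat J i x = max 0 (1 - |x * J - i|) := by
    intro i
    have : |x - (i : ℝ) / J| * J = |x * J - i| := by
      nth_rewrite 2 [← abs_of_pos hJ']
      rw [← abs_mul, sub_mul, div_mul_cancel₀ _ hJ'.ne']
    rw [hat, this]
  set m := ⌊x * J⌋₊ with hm
  have hm1 : (m : ℝ) ≤ x * J := Nat.floor_le hxJ0
  have hm2 : x * J < m + 1 := Nat.lt_floor_add_one _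
  have hmJ : m < J := (Nat.floor_lt hxJ0).2 (by nlinarith [hx.2])
  let a : Fin (J + 1) := ⟨m, by omega⟩
  let b : Fin (J + 1) := ⟨m + 1, by omega⟩
  have hab : a ≠ b := by simp [a, b]
  rw [← Finset.sum_subset (Finset.subset_univ {a, b}), Finset.sum_pair hab, hval, hval]
  · have ha : |x * J - (a : ℕ)| = x * J - m := abs_of_nonneg (by simp [a, hm1])
    have hb : |x * J - (b : ℕ)| = m + 1 - x * J := by
      have : ((b : ℕ) : ℝ) = m + 1 := by simp [b]
      rw [this, abs_of_nonpos (by linarith)]; ring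
    rw [ha, hb, max_eq_right (by linarith), max_eq_right (by linarith)]
    ring
  · intro i _ hi
    simp only [Finset.mem_insert, Finset.mem_singleton, not_or] at hi
    have h1 : (i : ℕ) ≠ m := fun h => hi.1 (Fin.ext h)
    have h2 : (i : ℕ) ≠ m + 1 := fun h => hi.2 (Fin.ext h)
    rw [hval]
    refine max_eq_left ?_
    rcases lt_or_ge (i : ℕ) m with h | h
    · have : ((i : ℕ) : ℝ) + 1 ≤ m := by exact_mod_cast h
      linarith [le_abs_self (x * J - (i : ℕ))]
    · have : (m : ℝ) + 2 ≤ ((i : ℕ) : ℝ) := by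
        have : m + 2 ≤ (i : ℕ) := by omega
        exact_mod_cast this
      linarith [neg_abs_le (x * J - (i : ℕ))]

/-- The hat functions are linearly independent in `L²(D)`, so that their Gram matrix is
invertible. -/
lemma isUnit_det_gram {J : ℕ} (hJ : 1 ≤ J) : IsUnit (gram J).det := by
  have hJ' : (0 : ℝ) < J := by exact_mod_cast hJ
  rw [isUnit_iff_ne_zero]
  intro hdet
  obtain ⟨v, hv, hGv⟩ := Matrix.exists_mulVec_eq_zero_iff.2 hdet
  set s : ℝ → ℝ := fun x => ∑ i, v i * hat J i x with hs
  have hsc : Continuous s := by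
    have := continuous_hat J
    fun_prop
  have hint : ∫ x in D, s x ^ 2 = 0 := by
    have i0 : ∀ i j, Integrable (fun x => v i * (v j * (hat J j x * hat J i x)))
        (volume.restrict D) := fun i j =>
      ((((memLp_hat J j).integrable_mul (memLp_hat J i)).const_mul _).const_mul _)
    have e : ∀ x, s x ^ 2 = ∑ i, ∑ j, v i * (v j * (hat J j x * hat J i x)) := fun x => by
      rw [sq, Finset.sum_mul_sum]
      exact Finset.sum_congr rfl fun i _ => Finset.sum_congr rfl fun j _ => by ring
    simp only [e]
    rw [integral_finsetSum _ fun i _ => integrable_finsetSum _ fun j _ => i0 i j]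
    refine Finset.sum_eq_zero fun i _ => ?_
    rw [integral_finsetSum _ fun j _ => i0 i j]
    simp only [integral_const_mul, ← Finset.mul_sum]
    have := congrFun hGv i
    simp only [Matrix.mulVec, dotProduct, gram, Matrix.of_apply, Pi.zero_apply] at this
    rw [show ∑ j, v j * ∫ x in D, hat J j x * hat J i x = 0 by
      rw [← this]; exact Finset.sum_congr rfl fun j _ => mul_comm _ _, mul_zero]
  have hz : ∀ x ∈ Icc (0 : ℝ) 1, s x = 0 := by
    have h1 : (fun x => s x ^ 2) =ᵐ[volume.restrict D] 0 :=
      (integral_eq_zero_iff_of_nonneg (fun x => sq_nonneg _)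
        ((memLp_D_of_continuous hsc 2).integrable_sq)).1 hint
    have h2 : EqOn (fun x => s x ^ 2) 0 D :=
      Measure.eqOn_open_of_ae_eq h1 isOpen_Ioo (hsc.pow 2).continuousOn continuousOn_const
    have h3 : EqOn (fun x => s x ^ 2) 0 (closure D) :=
      h2.closure (hsc.pow 2) continuous_const
    rw [D, closure_Ioo zero_ne_one] at h3
    exact fun x hx => pow_eq_zero_iff two_ne_zero |>.1 (h3 hx)
  refine hv (funext fun j => ?_)
  have hj : (j : ℝ) ≤ J := by exact_mod_cast Nat.lt_succ_iff.1 j.2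
  have := hz ((j : ℝ) / J) ⟨by positivity, (div_le_one hJ').2 hj⟩
  simpa [hs, hat_node hJ] using this

/-- The coefficients of the `L²(D)`-projection of `g` onto the span of the hat functions. -/
noncomputable def hatCoef (J : ℕ) (g : ℝ → ℝ) (m : Fin (J + 1)) : ℝ :=
  ∑ l, (gram J)⁻¹ l m * ∫ x in D, hat J l x * g x

/-- The `L²(D)`-orthogonal projection of `g` onto the span of the hat functions. -/
noncomputable def hatProj (J : ℕ) (g : ℝ → ℝ) (x : ℝ) : ℝ := ∑ m, hatCoef J g m * hat J m x

lemma continuous_hatProj (J : ℕ) (g : ℝ → ℝ) : Continuous (hatProj J g) := by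
  have := continuous_hat J
  unfold hatProj; fun_prop

lemma integral_sub_hatProj_mul_hat {J : ℕ} (hJ : 1 ≤ J) {g : ℝ → ℝ}
    (hg : MemLp g 2 (volume.restrict D)) (i : Fin (J + 1)) :
    ∫ x in D, (g x - hatProj J g x) * hat J i x = 0 := by
  have i0 : ∀ m, Integrable (fun x => hatCoef J g m * (hat J m x * hat J i x))
      (volume.restrict D) := fun m =>
    ((memLp_hat J m).integrable_mul (memLp_hat J i)).const_mul _
  have i1 : Integrable (fun x => hat J i x * g x) (volume.restrict D) :=
    (memLp_hat J i).integrable_mul hg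
  have e : ∀ x, (g x - hatProj J g x) * hat J i x =
      hat J i x * g x - ∑ m, hatCoef J g m * (hat J m x * hat J i x) := fun x => by
    rw [sub_mul, hatProj, Finset.sum_mul, mul_comm (g x)]
    simp only [mul_assoc]
  simp only [e]
  rw [integral_sub i1 (integrable_finsetSum _ fun m _ => i0 m), integral_finsetSum _ fun m _ => i0 m]
  simp only [integral_const_mul]
  simp only [hatCoef, Finset.sum_mul]
  rw [Finset.sum_comm]
  have e2 : ∀ l, ∑ m, (gram J)⁻¹ l m * (∫ x in D, hat J l x * g x) *
      ∫ x in D, hat J m x * hat J i x =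
        (if l = i then 1 else 0) * ∫ x in D, hat J l x * g x := by
    intro l
    have hinv : ((gram J)⁻¹ * gram J) l i = if l = i then 1 else 0 := by
      rw [Matrix.nonsing_inv_mul _ (isUnit_det_gram hJ), Matrix.one_apply]
    rw [← hinv, Matrix.mul_apply, Finset.sum_mul]
    refine Finset.sum_congr rfl fun m _ => ?_
    have : gram J m i = ∫ x in D, hat J m x * hat J i x := by
      simp only [gram, Matrix.of_apply, mul_comm]
    rw [this]; ring
  simp only [e2]
  simp

lemma integral_sub_hatProj_mul_sum {J : ℕ} (hJ : 1 ≤ J) {g : ℝ → ℝ}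
    (hg : MemLp g 2 (volume.restrict D)) (c : Fin (J + 1) → ℝ) :
    ∫ x in D, (g x - hatProj J g x) * ∑ i, c i * hat J i x = 0 := by
  have i0 : ∀ i, Integrable (fun x => c i * ((g x - hatProj J g x) * hat J i x))
      (volume.restrict D) := fun i =>
    ((hg.sub (memLp_D_of_continuous (continuous_hatProj J g) 2)).integrable_mul
      (memLp_hat J i)).const_mul _
  simp only [Finset.mul_sum, mul_left_comm _ (c _)]
  rw [integral_finsetSum _ fun i _ => i0 i]
  simp only [integral_const_mul, integral_sub_hatProj_mul_hat hJ hg, mul_zero,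
    Finset.sum_const_zero]

lemma integral_sub_hatProj_mul_hatProj {J : ℕ} (hJ : 1 ≤ J) {g : ℝ → ℝ}
    (hg : MemLp g 2 (volume.restrict D)) :
    ∫ x in D, (g x - hatProj J g x) * hatProj J g x = 0 :=
  integral_sub_hatProj_mul_sum hJ hg (hatCoef J g)

lemma integral_sub_hatProj_sq_le {J : ℕ} (hJ : 1 ≤ J) {g : ℝ → ℝ}
    (hg : MemLp g 2 (volume.restrict D)) (c : Fin (J + 1) → ℝ) :
    ∫ x in D, (g x - hatProj J g x) ^ 2 ≤ ∫ x in D, (g x - ∑ i, c i * hat J i x) ^ 2 :=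
  integral_sub_sq_le_of_orthogonal hg (memLp_D_of_continuous (continuous_hatProj J g) 2)
    (memLp_finsetSum _ fun i _ => (memLp_hat J i).const_mul (c i))
    (integral_sub_hatProj_mul_hatProj hJ hg) (integral_sub_hatProj_mul_sum hJ hg c)

lemma integral_sub_hatProj_sq_le_self {J : ℕ} (hJ : 1 ≤ J) {g : ℝ → ℝ}
    (hg : MemLp g 2 (volume.restrict D)) :
    ∫ x in D, (g x - hatProj J g x) ^ 2 ≤ ∫ x in D, g x ^ 2 := by
  simpa using integral_sub_hatProj_sq_le hJ hg 0

/-- Lipschitz functions are approximated to first order, by their nodal interpolants. -/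
lemma integral_sub_hatProj_sq_le_of_lipschitz {J : ℕ} (hJ : 1 ≤ J) {g : ℝ → ℝ}
    (hg : Continuous g) {L : ℝ} (hL : ∀ x y, |g x - g y| ≤ L * |x - y|) :
    ∫ x in D, (g x - hatProj J g x) ^ 2 ≤ (L / J) ^ 2 := by
  have hJ' : (0 : ℝ) < J := by exact_mod_cast hJ
  have hL0 : 0 ≤ L := by simpa using (abs_nonneg _).trans (hL 1 0)
  have hc : Continuous fun x => ∑ i : Fin (J + 1), g ((i : ℝ) / J) * hat J i x := by
    have := continuous_hat J
    fun_prop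
  calc ∫ x in D, (g x - hatProj J g x) ^ 2
      ≤ ∫ x in D, (g x - ∑ i : Fin (J + 1), g ((i : ℝ) / J) * hat J i x) ^ 2 :=
        integral_sub_hatProj_sq_le hJ (memLp_D_of_continuous hg 2) _
    _ ≤ ∫ x in D, (L / J) ^ 2 := by
        refine integral_mono_ae ((memLp_D_of_continuous (hg.sub hc) 2).integrable_sq)
          (integrable_const _) ?_
        filter_upwards [ae_restrict_mem (measurableSet_Ioo : MeasurableSet D)] with x hx
        rw [← sq_abs]
        refine pow_le_pow_left₀ (abs_nonneg _) ?_ 2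
        have e : g x - ∑ i : Fin (J + 1), g ((i : ℝ) / J) * hat J i x =
            ∑ i : Fin (J + 1), (g x - g ((i : ℝ) / J)) * hat J i x := by
          simp only [sub_mul, Finset.sum_sub_distrib, ← Finset.mul_sum, sum_hat hJ hx, mul_one]
        rw [e]
        calc _ ≤ ∑ i : Fin (J + 1), |(g x - g ((i : ℝ) / J)) * hat J i x| :=
              Finset.abs_sum_le_sum_abs _ _
          _ ≤ ∑ i : Fin (J + 1), L / J * hat J i x := by
              refine Finset.sum_le_sum fun i _ => ?_
              rw [abs_mul, abs_of_nonneg (hat_nonneg J i x)]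
              by_cases h0 : hat J i x = 0
              · simp [h0]
              · refine mul_le_mul_of_nonneg_right ((hL _ _).trans ?_) (hat_nonneg J i x)
                rw [div_eq_mul_one_div L]
                exact mul_le_mul_of_nonneg_left (abs_sub_le_of_hat_ne_zero hJ h0) hL0
          _ = L / J := by rw [← Finset.mul_sum, sum_hat hJ hx, mul_one]
    _ = (L / J) ^ 2 := by simp [D]

lemma lipschitz_deriv_eps (k : ℕ) (x y : ℝ) :
    |deriv (eps k) x - deriv (eps k) y| ≤ √2 * lam k ^ 2 * |x - y| := by
  have hd : ∀ z, HasDerivAt (deriv (eps k)) (-(√2 * lam k ^ 2 * Real.sin (lam k * z))) z := by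
    intro z
    rw [deriv_eps]
    refine ((((hasDerivAt_id z).const_mul (lam k)).cos).const_mul (√2 * lam k)).congr_deriv ?_
    simp only [id]; ring
  have h := Convex.norm_image_sub_le_of_norm_hasDerivWithin_le (s := univ) (C := √2 * lam k ^ 2)
    (fun z _ => (hd z).hasDerivWithinAt) (fun z _ => ?_) convex_univ (mem_univ y) (mem_univ x)
  · simpa using h
  · rw [Real.norm_eq_abs, abs_neg, abs_mul, abs_of_nonneg (by positivity)]
    exact mul_le_of_le_one_right (by positivity) (Real.abs_sin_le_one _)

/-- The projection error of `ε_k'`. -/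
lemma integral_deriv_eps_sub_hatProj_sq_le {J : ℕ} (hJ : 1 ≤ J) (k : ℕ) :
    ∫ x in D, (deriv (eps (k + 1)) x - hatProj J (deriv (eps (k + 1))) x) ^ 2 ≤
      lam (k + 1) ^ 2 * min 1 (2 * (lam (k + 1) / J) ^ 2) := by
  rw [mul_min_of_nonneg _ _ (sq_nonneg _), le_min_iff]
  constructor
  · rw [mul_one, ← integral_deriv_eps_sq]
    exact integral_sub_hatProj_sq_le_self hJ (memLp_D_of_continuous (continuous_deriv_eps _) 2)
  · refine (integral_sub_hatProj_sq_le_of_lipschitz hJ (continuous_deriv_eps _)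
      (lipschitz_deriv_eps _)).trans_eq ?_
    rw [div_pow, div_pow, mul_pow, Real.sq_sqrt zero_le_two]
    ring

/-! ### The projection onto piecewise constant functions of time -/

lemma measurableSet_timeCell (T : ℝ) (N : ℕ) (n : Fin N) : MeasurableSet (timeCell T N n) :=
  measurableSet_Ioo

lemma timeCell_subset {T : ℝ} (hT : 0 < T) {N : ℕ} (n : Fin N) : timeCell T N n ⊆ Icc 0 T := by
  have hN : (0 : ℝ) < N := by exact_mod_cast n.pos
  have hn : (n : ℝ) + 1 ≤ N := by exact_mod_cast n.2
  refine Ioo_subset_Icc_self.trans (Icc_subset_Icc (by positivity) ?_)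
  calc ((n : ℝ) + 1) * (T / N) ≤ N * (T / N) := by gcongr
    _ = T := by field_simp

lemma measureReal_timeCell {T : ℝ} (hT : 0 < T) {N : ℕ} (n : Fin N) :
    volume.real (timeCell T N n) = T / N := by
  have h : 0 ≤ T / N := by positivity
  rw [timeCell, Real.volume_real_Ioo_of_le (by linarith)]
  ring

lemma eq_of_mem_timeCell {T : ℝ} (hT : 0 < T) {N : ℕ} {n m : Fin N} {s : ℝ}
    (hn : s ∈ timeCell T N n) (hm : s ∈ timeCell T N m) : n = m := by
  have hN : (0 : ℝ) < N := by exact_mod_cast n.pos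
  have hΔ : 0 < T / N := by positivity
  have h1 : (n : ℝ) < m + 1 := lt_of_mul_lt_mul_right (hn.1.trans hm.2) hΔ.le
  have h2 : (m : ℝ) < n + 1 := lt_of_mul_lt_mul_right (hm.1.trans hn.2) hΔ.le
  ext
  have h1' : (n : ℕ) < m + 1 := by exact_mod_cast h1
  have h2' : (m : ℕ) < n + 1 := by exact_mod_cast h2
  omega

/-- The step function with value `c n` on the `n`-th time cell. -/
noncomputable def stepFun (T : ℝ) (N : ℕ) (c : Fin N → ℝ) (s : ℝ) : ℝ :=
  ∑ n, (timeCell T N n).indicator (fun _ => c n) s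

lemma stepFun_of_mem {T : ℝ} (hT : 0 < T) {N : ℕ} (c : Fin N → ℝ) {n : Fin N} {s : ℝ}
    (hs : s ∈ timeCell T N n) : stepFun T N c s = c n := by
  rw [stepFun, Finset.sum_eq_single n, indicator_of_mem hs]
  · intro m _ hm
    exact indicator_of_notMem (fun h => hm (eq_of_mem_timeCell hT h hs)) _
  · simp

lemma measurable_stepFun (T : ℝ) (N : ℕ) (c : Fin N → ℝ) : Measurable (stepFun T N c) :=
  Finset.measurable_sum _ fun n _ => measurable_const.indicator (measurableSet_timeCell T N n)

lemma memLp_stepFun (T : ℝ) (N : ℕ) (c : Fin N → ℝ) :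
    MemLp (stepFun T N c) 2 (volume.restrict (Icc 0 T)) :=
  memLp_finsetSum _ fun n _ =>
    memLp_indicator_const 2 (measurableSet_timeCell T N n) (c n) (Or.inr (measure_ne_top _ _))

/-- The finitely many nodes of the time partition. -/
noncomputable def timeNodes (T : ℝ) (N : ℕ) : Finset ℝ :=
  (Finset.range (N + 1)).image fun n : ℕ => (n : ℝ) * (T / N)

lemma exists_mem_timeCell {T : ℝ} (hT : 0 < T) {N : ℕ} (hN : 1 ≤ N) {s : ℝ} (hs : s ∈ Icc 0 T)
    (hs' : s ∉ timeNodes T N) : ∃ n, s ∈ timeCell T N n := by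
  have hN' : (0 : ℝ) < N := by exact_mod_cast hN
  have hΔ : 0 < T / N := by positivity
  have hq : 0 ≤ s / (T / N) := div_nonneg hs.1 hΔ.le
  have hnode : ∀ n : ℕ, n ≤ N → s ≠ n * (T / N) := fun n hn h =>
    hs' (Finset.mem_image.2 ⟨n, Finset.mem_range.2 (by omega), h.symm⟩)
  set m := ⌊s / (T / N)⌋₊ with hm
  have h1 : (m : ℝ) * (T / N) ≤ s := (le_div_iff₀ hΔ).1 (Nat.floor_le hq)
  have h2 : s < (m + 1) * (T / N) := (div_lt_iff₀ hΔ).1 (Nat.lt_floor_add_one _)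
  have hsT : s < T := lt_of_le_of_ne hs.2 fun h => hnode N le_rfl (by rw [h]; field_simp)
  have hmN : m < N := by
    refine (Nat.floor_lt hq).2 ?_
    rw [div_lt_iff₀ hΔ]
    calc s < T := hsT
      _ = N * (T / N) := by field_simp
  exact ⟨⟨m, hmN⟩, lt_of_le_of_ne h1 (hnode m hmN.le).symm, h2⟩

lemma ae_exists_mem_timeCell {T : ℝ} (hT : 0 < T) {N : ℕ} (hN : 1 ≤ N) :
    ∀ᵐ s ∂volume.restrict (Icc 0 T), ∃ n, s ∈ timeCell T N n := by
  have h : ∀ᵐ s ∂volume.restrict (Icc 0 T), s ∉ timeNodes T N :=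
    ae_restrict_of_ae ((timeNodes T N).countable_toSet.ae_notMem volume)
  filter_upwards [h, ae_restrict_mem measurableSet_Icc] with s hs hs'
  exact exists_mem_timeCell hT hN hs' hs

/-- The mean value of `f` over the `n`-th time cell. -/
noncomputable def cellMean (T : ℝ) (N : ℕ) (f : ℝ → ℝ) (n : Fin N) : ℝ :=
  (T / N)⁻¹ * ∫ s in timeCell T N n, f s

lemma integral_sub_cellMean_mul_stepFun {T : ℝ} (hT : 0 < T) {N : ℕ} {f : ℝ → ℝ}
    (hf : MemLp f 2 (volume.restrict (Icc 0 T))) (c : Fin N → ℝ) :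
    ∫ s in Icc 0 T, (f s - stepFun T N (cellMean T N f) s) * stepFun T N c s = 0 := by
  have hi : Integrable (fun s => f s - stepFun T N (cellMean T N f) s)
      (volume.restrict (Icc 0 T)) := (hf.sub (memLp_stepFun T N _)).integrable (by norm_num)
  have e : ∀ s, (f s - stepFun T N (cellMean T N f) s) * stepFun T N c s =
      ∑ n, (timeCell T N n).indicator
        (fun s => (f s - stepFun T N (cellMean T N f) s) * c n) s := fun s => by
    nth_rewrite 2 [stepFun]
    rw [Finset.mul_sum]
    refine Finset.sum_congr rfl fun n _ => ?_
    by_cases h : s ∈ timeCell T N n <;> simp [h]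
  simp only [e]
  rw [integral_finsetSum _ fun n _ => (hi.mul_const _).indicator (measurableSet_timeCell T N n)]
  refine Finset.sum_eq_zero fun n _ => ?_
  have hN : (0 : ℝ) < N := by exact_mod_cast n.pos
  have hΔ : T / N ≠ 0 := by positivity
  rw [integral_indicator (measurableSet_timeCell T N n),
    Measure.restrict_restrict (measurableSet_timeCell T N n),
    inter_eq_left.2 (timeCell_subset hT n), integral_mul_const]
  have h1 : ∫ s in timeCell T N n, (f s - stepFun T N (cellMean T N f) s) =
      ∫ s in timeCell T N n, (f s - cellMean T N f n) :=
    setIntegral_congr_fun (measurableSet_timeCell T N n) fun s hs => by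
      simp only [stepFun_of_mem hT _ hs]
  have hf1 : IntegrableOn f (timeCell T N n) :=
    IntegrableOn.mono_set (hf.integrable (by norm_num)) (timeCell_subset hT n)
  have hfin : volume (timeCell T N n) ≠ ∞ := by simp [timeCell]
  rw [h1, integral_sub hf1 (integrableOn_const hfin), setIntegral_const,
    measureReal_timeCell hT, cellMean, smul_eq_mul, mul_inv_cancel_left₀ hΔ, sub_self, zero_mul]

lemma integral_sub_cellMean_sq_le {T : ℝ} (hT : 0 < T) {N : ℕ} {f : ℝ → ℝ}
    (hf : MemLp f 2 (volume.restrict (Icc 0 T))) (c : Fin N → ℝ) :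
    ∫ s in Icc 0 T, (f s - stepFun T N (cellMean T N f) s) ^ 2 ≤
      ∫ s in Icc 0 T, (f s - stepFun T N c s) ^ 2 :=
  integral_sub_sq_le_of_orthogonal hf (memLp_stepFun T N _) (memLp_stepFun T N _)
    (integral_sub_cellMean_mul_stepFun hT hf _) (integral_sub_cellMean_mul_stepFun hT hf _)

lemma integral_sub_cellMean_sq_le_self {T : ℝ} (hT : 0 < T) {N : ℕ} {f : ℝ → ℝ}
    (hf : MemLp f 2 (volume.restrict (Icc 0 T))) :
    ∫ s in Icc 0 T, (f s - stepFun T N (cellMean T N f) s) ^ 2 ≤ ∫ s in Icc 0 T, f s ^ 2 := by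
  simpa [stepFun] using integral_sub_cellMean_sq_le hT hf (fun _ : Fin N => (0 : ℝ))

/-! ### The temporal profile of a mode -/

/-- The temporal profile `s ↦ 1_{(0,t)}(s) exp(-a (t - s))` of a mode with decay rate `a`. -/
noncomputable def profile (a t s : ℝ) : ℝ :=
  (Ioo 0 t).indicator (fun s => Real.exp (-(a * (t - s)))) s

lemma measurable_profile (a t : ℝ) : Measurable (profile a t) :=
  Measurable.indicator (by fun_prop) measurableSet_Ioo

lemma profile_nonneg (a t s : ℝ) : 0 ≤ profile a t s :=
  indicator_nonneg (fun _ _ => (Real.exp_pos _).le) s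

lemma profile_le {a m T t : ℝ} (ha : -a ≤ m) (hm : 0 ≤ m) (ht : t ≤ T) (s : ℝ) :
    profile a t s ≤ Real.exp (m * T) := by
  refine indicator_le' (fun s hs => Real.exp_le_exp.2 ?_) (fun _ _ => (Real.exp_pos _).le) s
  nlinarith [hs.1, hs.2, mul_le_mul_of_nonneg_right ha (sub_nonneg.2 hs.2.le)]

lemma memLp_profile (a T t : ℝ) : MemLp (profile a t) 2 (volume.restrict (Icc 0 T)) := by
  refine MemLp.of_bound (measurable_profile a t).aestronglyMeasurable
    (Real.exp (|a| * t)) (Filter.Eventually.of_forall fun s => ?_)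
  rw [Real.norm_eq_abs, abs_of_nonneg (profile_nonneg a t s)]
  exact profile_le (neg_le_abs a) (abs_nonneg a) le_rfl s

lemma integral_profile_mul {a T t : ℝ} (ht : t ∈ Icc 0 T) (g : ℝ → ℝ) :
    ∫ s in Icc 0 T, profile a t s * g s = ∫ s in (0 : ℝ)..t, Real.exp (-(a * (t - s))) * g s := by
  have e : ∀ s, profile a t s * g s =
      (Ioo 0 t).indicator (fun s => Real.exp (-(a * (t - s))) * g s) s := fun s => by
    by_cases h : s ∈ Ioo 0 t <;> simp [profile, h]
  simp only [e]
  rw [integral_indicator measurableSet_Ioo, Measure.restrict_restrict measurableSet_Ioo,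
    inter_eq_left.2 (Ioo_subset_Icc_self.trans (Icc_subset_Icc_right ht.2)),
    intervalIntegral.integral_of_le ht.1, integral_Ioc_eq_integral_Ioo]

lemma integral_profile_sq_le_of_pos {a T t : ℝ} (ha : 0 < a) (ht : t ∈ Icc 0 T) :
    ∫ s in Icc 0 T, profile a t s ^ 2 ≤ 1 / (2 * a) := by
  have e0 : ∀ s, profile a t s ^ 2 = profile a t s * profile a t s := fun s => sq _
  have e1 : ∫ s in Icc 0 T, profile a t s ^ 2 =
      ∫ s in (0 : ℝ)..t, Real.exp (-(a * (t - s))) * Real.exp (-(a * (t - s))) := by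
    simp only [e0]
    rw [integral_profile_mul ht]
    rw [intervalIntegral.integral_of_le ht.1, intervalIntegral.integral_of_le ht.1,
      integral_Ioc_eq_integral_Ioo, integral_Ioc_eq_integral_Ioo]
    refine setIntegral_congr_fun measurableSet_Ioo fun s hs => ?_
    simp [profile, indicator_of_mem hs]
  have hd : ∀ s ∈ uIcc 0 t, HasDerivAt (fun s => Real.exp (-(2 * a * (t - s))) / (2 * a))
      (Real.exp (-(a * (t - s))) * Real.exp (-(a * (t - s)))) s := by
    intro s _
    have h := ((((hasDerivAt_id s).const_sub t).const_mul (2 * a)).neg.exp).div_const (2 * a)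
    refine h.congr_deriv ?_
    rw [← Real.exp_add]
    simp only [id, Pi.neg_apply]
    field_simp
    ring_nf
  rw [e1, intervalIntegral.integral_eq_sub_of_hasDerivAt hd
    (Continuous.intervalIntegrable (by fun_prop) _ _)]
  simp only [sub_self, mul_zero, neg_zero, Real.exp_zero, sub_zero]
  have : 0 ≤ Real.exp (-(2 * a * t)) / (2 * a) := by positivity
  linarith

lemma integral_profile_sq_le {a m T t : ℝ} (ha : -a ≤ m) (hm : 0 ≤ m) (hT : 0 ≤ T) (ht : t ≤ T) :
    ∫ s in Icc 0 T, profile a t s ^ 2 ≤ T * Real.exp (m * T) ^ 2 := by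
  calc ∫ s in Icc 0 T, profile a t s ^ 2
      ≤ ∫ s in Icc 0 T, Real.exp (m * T) ^ 2 :=
        integral_mono (memLp_profile a T t).integrable_sq (integrable_const _) fun s =>
          pow_le_pow_left₀ (profile_nonneg a t s) (profile_le ha hm ht s) 2
    _ = T * Real.exp (m * T) ^ 2 := by simp [hT]

lemma one_sub_exp_neg_sq_le {r : ℝ} (hr : 0 ≤ r) : (1 - Real.exp (-r)) ^ 2 ≤ r := by
  have h1 : Real.exp (-r) ≤ 1 := Real.exp_le_one_iff.2 (by linarith)
  have h2 := Real.add_one_le_exp (-r)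
  nlinarith [Real.exp_pos (-r)]

/-- The cell means of a temporal profile approximate it to order `Δt ^ (1/2)` in `L²(0,T)`. The
profile is compared with the smaller of its two end point values on the cells to the left of `t`,
and with `0` on the other cells. -/
lemma integral_profile_sub_cellMean_sq_le {a m T t : ℝ} (ha : -a ≤ m) (hm : 0 ≤ m) (hT : 0 < T)
    (ht : t ≤ T) {N : ℕ} (hN : 1 ≤ N) :
    ∫ s in Icc 0 T, (profile a t s - stepFun T N (cellMean T N (profile a t)) s) ^ 2 ≤
      (|a| * (∫ s in Icc 0 T, profile a t s ^ 2) + Real.exp (m * T) ^ 2) * (T / N) := by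
  have hN' : (0 : ℝ) < N := by exact_mod_cast hN
  set Δ := T / N with hΔ
  have hΔ0 : 0 < Δ := by positivity
  let c : Fin N → ℝ := fun n => if ((n : ℝ) + 1) * Δ ≤ t then
    Real.exp (min (-(a * (t - n * Δ))) (-(a * (t - ((n : ℝ) + 1) * Δ)))) else 0
  have hpt : ∀ᵐ s ∂volume.restrict (Icc 0 T), (profile a t s - stepFun T N c s) ^ 2 ≤
      |a| * Δ * profile a t s ^ 2 +
        (Ioo (t - Δ) t).indicator (fun _ => Real.exp (m * T) ^ 2) s := by
    filter_upwards [ae_exists_mem_timeCell hT hN] with s hs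
    obtain ⟨n, hn⟩ := hs
    rw [stepFun_of_mem hT _ hn]
    have hn1 : (n : ℝ) * Δ < s := hn.1
    have hn2 : s < ((n : ℝ) + 1) * Δ := hn.2
    have hs0 : 0 < s := lt_of_le_of_lt (by positivity) hn1
    by_cases hnt : ((n : ℝ) + 1) * Δ ≤ t
    · have hst : s ∈ Ioo 0 t := ⟨hs0, hn2.trans_le hnt⟩
      have hp : profile a t s = Real.exp (-(a * (t - s))) := indicator_of_mem hst _
      have hc : c n = Real.exp (min (-(a * (t - n * Δ))) (-(a * (t - ((n : ℝ) + 1) * Δ)))) :=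
        if_pos hnt
      have h2 : 0 ≤ (Ioo (t - Δ) t).indicator (fun _ => Real.exp (m * T) ^ 2) s :=
        indicator_nonneg (fun _ _ => by positivity) s
      set q := min (-(a * (t - n * Δ))) (-(a * (t - ((n : ℝ) + 1) * Δ))) with hq
      have hqA : q ≤ -(a * (t - s)) := by
        rcases le_total 0 a with h | h
        · exact (min_le_left _ _).trans (by nlinarith)
        · exact (min_le_right _ _).trans (by nlinarith)
      have hAq : -(a * (t - s)) - q ≤ |a| * Δ := by
        have e1 : |a * (s - n * Δ)| ≤ |a| * Δ := by
          rw [abs_mul]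
          refine mul_le_mul_of_nonneg_left ?_ (abs_nonneg a)
          rw [abs_of_pos (by linarith)]; linarith
        have e2 : |a * (s - (n + 1) * Δ)| ≤ |a| * Δ := by
          rw [abs_mul]
          refine mul_le_mul_of_nonneg_left ?_ (abs_nonneg a)
          rw [abs_of_neg (by linarith)]; linarith
        rcases min_choice (-(a * (t - n * Δ))) (-(a * (t - ((n : ℝ) + 1) * Δ))) with h | h
        · rw [hq, h]; linarith [le_abs_self (a * (s - n * Δ))]
        · rw [hq, h]; linarith [le_abs_self (a * (s - (n + 1) * Δ))]
      have e : profile a t s - c n =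
          profile a t s * (1 - Real.exp (-(-(a * (t - s)) - q))) := by
        rw [hp, hc, mul_sub (Real.exp _), mul_one, ← Real.exp_add]; congr 2; ring
      have h3 := (one_sub_exp_neg_sq_le (sub_nonneg.2 hqA)).trans hAq
      rw [e, mul_pow]
      nlinarith [mul_le_mul_of_nonneg_left h3 (sq_nonneg (profile a t s))]
    · have hc : c n = 0 := if_neg hnt
      have h1 : 0 ≤ |a| * Δ * profile a t s ^ 2 := by positivity
      rw [hc, sub_zero]
      by_cases hst : s < t
      · rw [indicator_of_mem (show s ∈ Ioo (t - Δ) t from ⟨by linarith, hst⟩)]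
        have := pow_le_pow_left₀ (profile_nonneg a t s) (profile_le ha hm ht s) 2
        linarith
      · have hp : profile a t s = 0 := indicator_of_notMem (fun h => hst h.2) _
        have h2 : 0 ≤ (Ioo (t - Δ) t).indicator (fun _ => Real.exp (m * T) ^ 2) s :=
          indicator_nonneg (fun _ _ => by positivity) s
        rw [hp]
        simpa using h2
  have hind : Integrable ((Ioo (t - Δ) t).indicator fun _ : ℝ => Real.exp (m * T) ^ 2)
      (volume.restrict (Icc 0 T)) := (integrable_const _).indicator measurableSet_Ioo
  have hsq := (memLp_profile a T t).integrable_sq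
  calc _ ≤ ∫ s in Icc 0 T, (profile a t s - stepFun T N c s) ^ 2 :=
        integral_sub_cellMean_sq_le hT (memLp_profile a T t) c
    _ ≤ ∫ s in Icc 0 T, (|a| * Δ * profile a t s ^ 2 +
        (Ioo (t - Δ) t).indicator (fun _ => Real.exp (m * T) ^ 2) s) :=
        integral_mono_ae ((memLp_profile a T t).sub (memLp_stepFun T N c)).integrable_sq
          ((hsq.const_mul _).add hind) hpt
    _ = |a| * Δ * (∫ s in Icc 0 T, profile a t s ^ 2) +
        ∫ s in Icc 0 T, (Ioo (t - Δ) t).indicator (fun _ => Real.exp (m * T) ^ 2) s := by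
        rw [integral_add (hsq.const_mul _) hind, integral_const_mul]
    _ ≤ |a| * Δ * (∫ s in Icc 0 T, profile a t s ^ 2) + Real.exp (m * T) ^ 2 * Δ := by
        gcongr
        rw [integral_indicator measurableSet_Ioo, Measure.restrict_restrict measurableSet_Ioo,
          setIntegral_const, smul_eq_mul, mul_comm]
        refine mul_le_mul_of_nonneg_left ?_ (by positivity)
        calc volume.real (Ioo (t - Δ) t ∩ Icc 0 T) ≤ volume.real (Ioo (t - Δ) t) :=
              measureReal_mono inter_subset_left (by simp)
          _ = Δ := by rw [Real.volume_real_Ioo_of_le (by linarith)]; ring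
    _ = _ := by ring

/-! ### The approximation error of a single mode and its summation over the modes -/

/-- The decay rate `λ_k² (λ_k² - μ)` of the `k`-th mode. -/
noncomputable def rate (μ : ℝ) (k : ℕ) : ℝ := lam k ^ 2 * (lam k ^ 2 - μ)

lemma neg_rate_le (μ : ℝ) (k : ℕ) : -rate μ k ≤ μ ^ 2 / 4 := by
  unfold rate; nlinarith [sq_nonneg (lam k ^ 2 - μ / 2)]

lemma succ_le_lam (j : ℕ) : (j : ℝ) + 1 ≤ lam (j + 1) := by
  have h : (1 : ℝ) ≤ Real.pi := by linarith [Real.pi_gt_three]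
  have h2 : (0 : ℝ) ≤ (j : ℝ) + 1 := by positivity
  unfold lam
  push_cast
  nlinarith

lemma lam_sq_le (j : ℕ) : lam (j + 1) ^ 2 ≤ 10 * ((j : ℝ) + 1) ^ 2 := by
  have h : Real.pi ^ 2 ≤ 10 := by nlinarith [Real.pi_lt_d2, Real.pi_pos]
  have h2 : (0 : ℝ) ≤ ((j : ℝ) + 1) ^ 2 := by positivity
  unfold lam
  push_cast
  nlinarith

lemma abs_rate_le (μ : ℝ) (j : ℕ) : |rate μ (j + 1)| ≤ (1 + |μ|) * lam (j + 1) ^ 4 := by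
  have h1 : 1 ≤ lam (j + 1) := by
    have : (0 : ℝ) ≤ j := by positivity
    linarith [succ_le_lam j]
  have h2 : 1 ≤ lam (j + 1) ^ 2 := one_le_pow₀ h1
  rw [rate, abs_mul, abs_of_nonneg (sq_nonneg _)]
  have h3 : |lam (j + 1) ^ 2 - μ| ≤ lam (j + 1) ^ 2 + |μ| := by
    refine (abs_sub _ _).trans ?_
    rw [abs_of_nonneg (sq_nonneg (lam (j + 1)))]
  have h4 : lam (j + 1) ^ 2 * |lam (j + 1) ^ 2 - μ| ≤ lam (j + 1) ^ 2 * (lam (j + 1) ^ 2 + |μ|) := by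
    gcongr
  have h5 : 0 ≤ |μ| * lam (j + 1) ^ 2 * (lam (j + 1) ^ 2 - 1) :=
    mul_nonneg (by positivity) (by linarith)
  nlinarith

/-- A bound for all temporal profiles on `[0,T]`. -/
noncomputable def profileBound (T μ : ℝ) : ℝ := Real.exp (μ ^ 2 / 4 * T)

/-- The constant in the bound `‖1_{(0,t)} exp(-a_k (t - ·))‖² ≤ C / λ_k⁴`. -/
noncomputable def energyConst (T μ : ℝ) : ℝ := 1 + 4 * μ ^ 2 * (T * profileBound T μ ^ 2)

lemma one_le_energyConst {T : ℝ} (hT : 0 ≤ T) (μ : ℝ) : 1 ≤ energyConst T μ := by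
  have : 0 ≤ 4 * μ ^ 2 * (T * profileBound T μ ^ 2) := by positivity
  unfold energyConst; linarith

/-- Modes with `λ_k² ≥ 2 μ` are damped at the rate `λ_k⁴ / 2` at least, and the finitely many others
only affect the constant. -/
lemma integral_profile_rate_sq_le {T : ℝ} (hT : 0 ≤ T) (μ : ℝ) {t : ℝ} (ht : t ∈ Icc 0 T) (j : ℕ) :
    ∫ s in Icc 0 T, profile (rate μ (j + 1)) t s ^ 2 ≤ energyConst T μ / lam (j + 1) ^ 4 := by
  have hlam : 0 < lam (j + 1) := by
    have : (0 : ℝ) ≤ j := by positivity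
    linarith [succ_le_lam j]
  rcases le_total (2 * μ) (lam (j + 1) ^ 2) with h | h
  · have ha : lam (j + 1) ^ 4 / 2 ≤ rate μ (j + 1) := by
      unfold rate; nlinarith [mul_nonneg (sq_nonneg (lam (j + 1))) (sub_nonneg.2 h)]
    have h4 : 0 < lam (j + 1) ^ 4 := by positivity
    calc _ ≤ 1 / (2 * rate μ (j + 1)) := integral_profile_sq_le_of_pos (by linarith) ht
      _ ≤ 1 / lam (j + 1) ^ 4 := one_div_le_one_div_of_le h4 (by linarith)
      _ ≤ _ := by gcongr; exact one_le_energyConst hT μ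
  · refine (integral_profile_sq_le (neg_rate_le μ (j + 1)) (by positivity) hT ht.2).trans ?_
    change T * profileBound T μ ^ 2 ≤ _
    rw [le_div_iff₀ (by positivity)]
    have h1 : lam (j + 1) ^ 4 ≤ 4 * μ ^ 2 := by nlinarith [sq_nonneg (lam (j + 1))]
    have h2 : 0 ≤ T * profileBound T μ ^ 2 := by positivity
    unfold energyConst
    nlinarith

/-- `f_k(s,y) = 1_{(0,t)}(s) exp(-a_k (t - s)) ε_k'(y)`: up to sign, the integrand whose stochastic
integral is the `k`-th Fourier coefficient of the mild solution. -/
noncomputable def modeFun (μ t : ℝ) (k : ℕ) (z : ℝ × ℝ) : ℝ :=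
  profile (rate μ k) t z.1 * deriv (eps k) z.2

/-- The projection of `modeFun` onto the span of the products of indicators of time cells and hat
functions: up to sign, the integrand whose stochastic integral is the `k`-th Fourier coefficient of
the solution of the regularized problem. -/
noncomputable def modeProj (T μ : ℝ) (N J : ℕ) (t : ℝ) (k : ℕ) (z : ℝ × ℝ) : ℝ :=
  stepFun T N (cellMean T N (profile (rate μ k) t)) z.1 * hatProj J (deriv (eps k)) z.2

lemma memLp_prod {α β : Type*} [MeasurableSpace α] [MeasurableSpace β] {τ : Measure α}
    {σ : Measure β} [SFinite τ] [SFinite σ] {f : α → ℝ} {g : β → ℝ} (hf : MemLp f 2 τ)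
    (hg : MemLp g 2 σ) : MemLp (fun z : α × β => f z.1 * g z.2) 2 (τ.prod σ) := by
  have hm : AEStronglyMeasurable (fun z : α × β => f z.1 * g z.2) (τ.prod σ) :=
    hf.1.comp_fst.mul hg.1.comp_snd
  rw [memLp_two_iff_integrable_sq hm]
  simp only [mul_pow]
  exact hf.integrable_sq.mul_prod hg.integrable_sq

lemma spaceTime_eq (T : ℝ) :
    spaceTime T = (volume.restrict (Icc 0 T)).prod (volume.restrict D) := by
  rw [spaceTime, Measure.prod_restrict]; rfl

instance isFiniteMeasure_spaceTime (T : ℝ) : IsFiniteMeasure (spaceTime T) := by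
  rw [spaceTime_eq]; infer_instance

lemma memLp_deriv_eps (k : ℕ) : MemLp (deriv (eps k)) 2 (volume.restrict D) :=
  memLp_D_of_continuous (continuous_deriv_eps k) 2

lemma memLp_modeFun (T μ t : ℝ) (k : ℕ) : MemLp (modeFun μ t k) 2 (spaceTime T) := by
  rw [spaceTime_eq]; exact memLp_prod (memLp_profile _ T t) (memLp_deriv_eps k)

lemma memLp_modeProj (T μ : ℝ) (N J : ℕ) (t : ℝ) (k : ℕ) :
    MemLp (modeProj T μ N J t k) 2 (spaceTime T) := by
  rw [spaceTime_eq]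
  exact memLp_prod (memLp_stepFun T N _) (memLp_D_of_continuous (continuous_hatProj J _) 2)

lemma integral_modeFun_sq_le {T : ℝ} (hT : 0 ≤ T) (μ : ℝ) {t : ℝ} (ht : t ∈ Icc 0 T) (j : ℕ) :
    ∫ z, modeFun μ t (j + 1) z ^ 2 ∂spaceTime T ≤ energyConst T μ * (1 / ((j : ℝ) + 1) ^ 2) := by
  have h1 := succ_le_lam j
  have hj : (0 : ℝ) < (j : ℝ) + 1 := by positivity
  have hlam : 0 < lam (j + 1) := hj.trans_le h1
  have hB := one_le_energyConst hT μ
  simp only [modeFun, mul_pow]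
  rw [spaceTime_eq, integral_prod_mul (fun s => profile (rate μ (j + 1)) t s ^ 2)
    (fun y => deriv (eps (j + 1)) y ^ 2), integral_deriv_eps_sq]
  calc _ ≤ energyConst T μ / lam (j + 1) ^ 4 * lam (j + 1) ^ 2 := by
        gcongr; exact integral_profile_rate_sq_le hT μ ht j
    _ = energyConst T μ * (1 / lam (j + 1) ^ 2) := by field_simp
    _ ≤ _ := by gcongr

/-- The constant in the error bound for a single mode. -/
noncomputable def modeConst (T μ : ℝ) : ℝ :=
  (1 + |μ|) * energyConst T μ + profileBound T μ ^ 2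

lemma energyConst_le_modeConst {T : ℝ} (hT : 0 ≤ T) (μ : ℝ) : energyConst T μ ≤ modeConst T μ := by
  have h1 := one_le_energyConst hT μ
  have h2 : 0 ≤ |μ| * energyConst T μ := by positivity
  have h3 := sq_nonneg (profileBound T μ)
  unfold modeConst; nlinarith

lemma integral_modeFun_sub_modeProj_sq_le {T : ℝ} (hT : 0 < T) (μ : ℝ) {t : ℝ} (ht : t ∈ Icc 0 T)
    {N J : ℕ} (hN : 1 ≤ N) (hJ : 1 ≤ J) (j : ℕ) :
    ∫ z, (modeFun μ t (j + 1) z - modeProj T μ N J t (j + 1) z) ^ 2 ∂spaceTime T ≤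
      10 * modeConst T μ * (min (1 / ((j : ℝ) + 1) ^ 2) (1 / (J : ℝ) ^ 2)
        + min (1 / ((j : ℝ) + 1) ^ 2) (((j : ℝ) + 1) ^ 2 * (T / N))) := by
  have h1 := succ_le_lam j
  have hj : (0 : ℝ) < (j : ℝ) + 1 := by positivity
  have hJ' : (0 : ℝ) < J := by exact_mod_cast hJ
  have hlam : 0 < lam (j + 1) := hj.trans_le h1
  have hB := one_le_energyConst hT.le μ
  have hBB := energyConst_le_modeConst hT.le μ
  have hE0 : 0 < energyConst T μ := by linarith
  have hM0 : 0 < modeConst T μ := by linarith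
  set k : ℝ := (j : ℝ) + 1
  set l := lam (j + 1)
  set B := energyConst T μ
  set B' := modeConst T μ
  set a := rate μ (j + 1)
  have hφ := integral_profile_rate_sq_le hT.le μ ht j
  have hmp := memLp_profile a T t
  have hd := memLp_deriv_eps (j + 1)
  have hdt := integral_profile_sub_cellMean_sq_le (neg_rate_le μ (j + 1)) (by positivity) hT ht.2 hN
  have hkl : 1 / l ^ 2 ≤ 1 / k ^ 2 := by gcongr
  have hl10 : l ^ 2 ≤ 10 * k ^ 2 := lam_sq_le j
  have hΔ : 0 ≤ T / N := by positivity
  have htens := integral_prod_sub_sq_le hmp (memLp_stepFun T N (cellMean T N (profile a t)))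
    hd (memLp_D_of_continuous (continuous_hatProj J _) 2)
    (integral_sub_cellMean_mul_stepFun hT hmp _) (integral_sub_hatProj_mul_hatProj hJ hd)
  rw [← spaceTime_eq] at htens
  refine htens.trans ?_
  rw [mul_add, integral_deriv_eps_sq]
  refine add_le_add ?_ ?_
  · calc _ ≤ B / l ^ 4 * (l ^ 2 * min 1 (2 * (l / J) ^ 2)) :=
          mul_le_mul hφ (integral_deriv_eps_sub_hatProj_sq_le hJ j)
            (integral_nonneg fun _ => sq_nonneg _) (by positivity)
      _ = B * min (1 / l ^ 2) (2 * (1 / (J : ℝ) ^ 2)) := by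
          rw [← mul_assoc, mul_min_of_nonneg _ _ (by positivity), mul_min_of_nonneg _ _ hE0.le]
          congr 1 <;> field_simp
      _ ≤ B' * (10 * min (1 / k ^ 2) (1 / (J : ℝ) ^ 2)) := by
          have hk0 : 0 ≤ 1 / k ^ 2 := by positivity
          have hJ0 : 0 ≤ 1 / (J : ℝ) ^ 2 := by positivity
          refine mul_le_mul hBB ?_ (by positivity) hM0.le
          rw [mul_min_of_nonneg _ _ (by norm_num)]
          exact min_le_min (by linarith) (by linarith)
      _ = _ := by ring
  · have e1 : ∫ s in Icc 0 T, (profile a t s - stepFun T N (cellMean T N (profile a t)) s) ^ 2 ≤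
        min (B' / l ^ 4) (B' * (T / N)) := by
      refine le_min ?_ (hdt.trans ?_)
      · refine ((integral_sub_cellMean_sq_le_self hT hmp).trans hφ).trans ?_
        gcongr
      · refine mul_le_mul_of_nonneg_right ?_ hΔ
        refine add_le_add ?_ le_rfl
        calc |a| * ∫ s in Icc 0 T, profile a t s ^ 2
            ≤ ((1 + |μ|) * l ^ 4) * (B / l ^ 4) :=
              mul_le_mul (abs_rate_le μ j) hφ (integral_nonneg fun _ => sq_nonneg _) (by positivity)
          _ = (1 + |μ|) * B := by field_simp
    calc _ ≤ l ^ 2 * min (B' / l ^ 4) (B' * (T / N)) := by gcongr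
      _ = B' * min (1 / l ^ 2) (l ^ 2 * (T / N)) := by
          rw [mul_min_of_nonneg _ _ (sq_nonneg l), mul_min_of_nonneg _ _ hM0.le]
          congr 1
          · field_simp
          · ring
      _ ≤ B' * (10 * min (1 / k ^ 2) (k ^ 2 * (T / N))) := by
          have hk0 : 0 ≤ 1 / k ^ 2 := by positivity
          gcongr
          rw [mul_min_of_nonneg _ _ (by norm_num)]
          refine min_le_min (by linarith) ?_
          rw [← mul_assoc]
          gcongr
      _ = _ := by ring

lemma sum_Ico_one_div_sq_le {m : ℕ} (hm : 1 ≤ m) (K : ℕ) :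
    ∑ j ∈ Finset.Ico m K, 1 / ((j : ℝ) + 1) ^ 2 ≤ 1 / (m : ℝ) := by
  have hm' : (0 : ℝ) < m := by exact_mod_cast hm
  rcases le_total K m with h | h
  · rw [Finset.Ico_eq_empty_of_le h, Finset.sum_empty]; positivity
  · suffices ∑ j ∈ Finset.Ico m K, 1 / ((j : ℝ) + 1) ^ 2 ≤ 1 / (m : ℝ) - 1 / K from
      this.trans (sub_le_self _ (by positivity))
    induction K, h using Nat.le_induction with
    | base => simp
    | succ K hK ih =>
      have hK' : (0 : ℝ) < K := by exact_mod_cast hm.trans hK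
      rw [Finset.sum_Ico_succ_top hK]
      have : 1 / ((K : ℝ) + 1) ^ 2 ≤ 1 / K - 1 / ((K : ℝ) + 1) := by
        rw [div_sub_div _ _ hK'.ne' (by positivity), div_le_div_iff₀ (by positivity) (by positivity)]
        nlinarith
      push_cast
      linarith

lemma sum_min_one_div_sq_le {b : ℕ → ℝ} (hb : ∀ j, 0 ≤ b j) {m : ℕ} (hm : 1 ≤ m) (K : ℕ) :
    ∑ j ∈ Finset.range K, min (1 / ((j : ℝ) + 1) ^ 2) (b j) ≤
      ∑ j ∈ Finset.range m, b j + 1 / (m : ℝ) := by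
  have h0 : ∀ j : ℕ, 0 ≤ min (1 / ((j : ℝ) + 1) ^ 2) (b j) :=
    fun j => le_min (by positivity) (hb j)
  calc _ ≤ ∑ j ∈ Finset.range (max m K), min (1 / ((j : ℝ) + 1) ^ 2) (b j) :=
        Finset.sum_le_sum_of_subset_of_nonneg (Finset.range_mono (le_max_right m K))
          fun j _ _ => h0 j
    _ = ∑ j ∈ Finset.range m, min (1 / ((j : ℝ) + 1) ^ 2) (b j) +
          ∑ j ∈ Finset.Ico m (max m K), min (1 / ((j : ℝ) + 1) ^ 2) (b j) :=
        (Finset.sum_range_add_sum_Ico _ (le_max_left m K)).symm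
    _ ≤ ∑ j ∈ Finset.range m, b j + ∑ j ∈ Finset.Ico m (max m K), 1 / ((j : ℝ) + 1) ^ 2 :=
        add_le_add (Finset.sum_le_sum fun j _ => min_le_right _ _)
          (Finset.sum_le_sum fun j _ => min_le_left _ _)
    _ ≤ _ := by gcongr; exact sum_Ico_one_div_sq_le hm _

lemma sum_min_space_le {J : ℕ} (hJ : 1 ≤ J) (K : ℕ) :
    ∑ j ∈ Finset.range K, min (1 / ((j : ℝ) + 1) ^ 2) (1 / (J : ℝ) ^ 2) ≤ 9 * (1 / (J : ℝ)) := by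
  have hJ' : (0 : ℝ) < J := by exact_mod_cast hJ
  refine (sum_min_one_div_sq_le (fun _ => by positivity) hJ K).trans ?_
  rw [Finset.sum_const, Finset.card_range, nsmul_eq_mul]
  have e : (J : ℝ) * (1 / (J : ℝ) ^ 2) = 1 / J := by field_simp
  have : 0 ≤ 1 / (J : ℝ) := by positivity
  rw [e]; linarith

/-- The two terms balance at the mode number `1 / x`. -/
lemma sum_min_time_le {x : ℝ} (hx : 0 < x) (K : ℕ) :
    ∑ j ∈ Finset.range K, min (1 / ((j : ℝ) + 1) ^ 2) (((j : ℝ) + 1) ^ 2 * x ^ 4) ≤ 9 * x := by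
  rcases le_total x 1 with h | h
  · have hr : 1 ≤ 1 / x := (one_le_div hx).2 h
    set m := ⌈1 / x⌉₊ with hm
    have hm1 : 1 / x ≤ m := Nat.le_ceil _
    have hm0 : (0 : ℝ) < m := by linarith
    have hm2 : (m : ℝ) ≤ 2 * (1 / x) := by
      have := Nat.ceil_lt_add_one (show 0 ≤ 1 / x by positivity)
      linarith
    have hmx : (m : ℝ) * x ≤ 2 := by
      calc (m : ℝ) * x ≤ 2 * (1 / x) * x := by gcongr
        _ = 2 := by field_simp
    refine (sum_min_one_div_sq_le (fun _ => by positivity)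
      (Nat.ceil_pos.2 (by positivity : 0 < 1 / x)) K).trans ?_
    have h1 : ∑ j ∈ Finset.range m, ((j : ℝ) + 1) ^ 2 * x ^ 4 ≤ 8 * x := by
      calc _ ≤ ∑ j ∈ Finset.range m, (m : ℝ) ^ 2 * x ^ 4 := by
            refine Finset.sum_le_sum fun j hj => ?_
            have : (j : ℝ) + 1 ≤ m := by exact_mod_cast Finset.mem_range.1 hj
            gcongr
        _ = (m * x) ^ 3 * x := by
            rw [Finset.sum_const, Finset.card_range, nsmul_eq_mul]; ring
        _ ≤ 2 ^ 3 * x := by gcongr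
        _ = 8 * x := by norm_num
    have h2 : 1 / (m : ℝ) ≤ x := by
      rw [div_le_iff₀ hm0]
      rw [div_le_iff₀ hx] at hm1
      linarith
    linarith
  · calc _ ≤ ∑ j ∈ Finset.range K, min (1 / ((j : ℝ) + 1) ^ 2) 1 := by
          refine Finset.sum_le_sum fun j _ => le_min (min_le_left _ _) ((min_le_left _ _).trans ?_)
          have hj : (0 : ℝ) ≤ j := by positivity
          rw [div_le_one (by positivity)]
          nlinarith
      _ ≤ ∑ j ∈ Finset.range 1, (1 : ℝ) + 1 / ((1 : ℕ) : ℝ) :=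
          sum_min_one_div_sq_le (fun _ => zero_le_one) le_rfl K
      _ ≤ 9 * x := by norm_num; linarith

/-- The total error of the modes below `K`. -/
lemma sum_integral_modeFun_sub_modeProj_sq_le {T : ℝ} (hT : 0 < T) (μ : ℝ) {t : ℝ}
    (ht : t ∈ Icc 0 T) {N J : ℕ} (hN : 1 ≤ N) (hJ : 1 ≤ J) (K : ℕ) :
    ∑ j ∈ Finset.range K,
      ∫ z, (modeFun μ t (j + 1) z - modeProj T μ N J t (j + 1) z) ^ 2 ∂spaceTime T ≤
      90 * modeConst T μ * (1 / (J : ℝ) + (T / N) ^ (1 / 4 : ℝ)) := by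
  have hN' : (0 : ℝ) < N := by exact_mod_cast hN
  have hM0 : 0 < modeConst T μ := by
    linarith [one_le_energyConst hT.le μ, energyConst_le_modeConst hT.le μ]
  have hx : 0 < (T / N) ^ (1 / 4 : ℝ) := by positivity
  have hx4 : ((T / N) ^ (1 / 4 : ℝ)) ^ 4 = T / N := by
    rw [← Real.rpow_natCast, ← Real.rpow_mul (by positivity)]; norm_num
  refine (Finset.sum_le_sum fun j _ =>
    integral_modeFun_sub_modeProj_sq_le hT μ ht hN hJ j).trans ?_
  rw [← Finset.mul_sum, Finset.sum_add_distrib]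
  have h1 := sum_min_space_le hJ K
  have h2 := sum_min_time_le hx K
  rw [hx4] at h2
  calc _ ≤ 10 * modeConst T μ * (9 * (1 / J) + 9 * (T / N) ^ (1 / 4 : ℝ)) := by gcongr
    _ = _ := by ring

/-! ### The Fourier coefficients of the solution of the regularized problem -/

lemma isTestFunction_eps (k : ℕ) : IsTestFunction (eps k) ∧
    iteratedDeriv 2 (eps k) = (fun x => -lam k ^ 2 * eps k x) ∧
    iteratedDeriv 4 (eps k) = fun x => lam k ^ 4 * eps k x := by
  have h2 : iteratedDeriv 2 (eps k) = fun x => -lam k ^ 2 * eps k x := by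
    rw [iteratedDeriv_succ, iteratedDeriv_one, deriv_eps]
    funext z
    have h := (((hasDerivAt_id z).const_mul (lam k)).cos).const_mul (√2 * lam k)
    refine h.deriv.trans ?_
    simp only [id, eps]; ring
  have h4 : iteratedDeriv 4 (eps k) = fun x => lam k ^ 4 * eps k x := by
    have e : iteratedDeriv 4 (eps k) = iteratedDeriv 2 (iteratedDeriv 2 (eps k)) := by
      simp only [iteratedDeriv_eq_iterate, ← Function.iterate_add_apply]
    rw [e, h2]
    funext z
    rw [iteratedDeriv_const_mul_field, h2]
    ring
  refine ⟨⟨?_, ?_, ?_, ?_, ?_⟩, h2, h4⟩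
  · unfold eps; fun_prop
  · simp [eps]
  · simp [eps, lam_sin_eq_zero]
  · simp [h2, eps]
  · simp [h2, eps, lam_sin_eq_zero]

lemma continuousAt_stepFun {T : ℝ} (hT : 0 < T) {N : ℕ} (c : Fin N → ℝ) {n : Fin N} {s : ℝ}
    (hs : s ∈ timeCell T N n) : ContinuousAt (stepFun T N c) s := by
  have h : stepFun T N c =ᶠ[nhds s] fun _ => c n :=
    Filter.eventually_of_mem (isOpen_Ioo.mem_nhds hs) fun _ hx => stepFun_of_mem hT c hx
  exact continuousAt_const.congr h.symm

lemma intervalIntegrable_stepFun {T : ℝ} (N : ℕ) (c : Fin N → ℝ) (a b : ℝ) :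
    IntervalIntegrable (stepFun T N c) volume a b := by
  rw [intervalIntegrable_iff]
  have : IsFiniteMeasure (volume.restrict (uIoc a b)) := ⟨by simp [uIoc]⟩
  have : MemLp (stepFun T N c) 1 (volume.restrict (uIoc a b)) := memLp_finsetSum _ fun n _ =>
    memLp_indicator_const 1 (measurableSet_timeCell T N n) (c n) (Or.inr (measure_ne_top _ _))
  exact this.integrable le_rfl

/-- Duhamel's formula for `y' + a y = -h` with a step function `h`. The equation is given in
integrated form, and `y` is only known to be such that `a y` is integrable. -/
lemma duhamel {T : ℝ} (hT : 0 < T) {N : ℕ} (hN : 1 ≤ N) (c : Fin N → ℝ) {a : ℝ} {y : ℝ → ℝ}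
    (hint : IntervalIntegrable (fun s => a * y s) volume 0 T)
    (hy : ∀ t ∈ Icc 0 T, y t + ∫ s in (0 : ℝ)..t, a * y s = -∫ s in (0 : ℝ)..t, stepFun T N c s)
    {t : ℝ} (ht : t ∈ Icc 0 T) :
    y t = -∫ s in (0 : ℝ)..t, Real.exp (-(a * (t - s))) * stepFun T N c s := by
  have hprim : ∀ f : ℝ → ℝ, IntervalIntegrable f volume 0 T →
      ContinuousOn (fun t => ∫ s in (0 : ℝ)..t, f s) (Icc 0 T) := by
    intro f hf
    have := intervalIntegral.continuousOn_primitive_interval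
      (μ := volume) (f := f) (a := 0) (b := T) (by
        rw [uIcc_of_le hT.le]
        exact (intervalIntegrable_iff_integrableOn_Icc_of_le hT.le).1 hf)
    rwa [uIcc_of_le hT.le] at this
  have hye : ∀ t ∈ Icc 0 T,
      y t = -(∫ s in (0 : ℝ)..t, stepFun T N c s) - ∫ s in (0 : ℝ)..t, a * y s :=
    fun t ht => by linarith [hy t ht]
  have hyc : ContinuousOn y (Icc 0 T) :=
    (((hprim _ (intervalIntegrable_stepFun N c 0 T)).neg).sub (hprim _ hint)).congr hye
  have hyc' : ContinuousOn (fun s => a * y s) (Ioo 0 T) :=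
    (continuousOn_const.mul hyc).mono Ioo_subset_Icc_self
  have hder : ∀ s ∈ Ioo 0 t \ (timeNodes T N : Set ℝ),
      HasDerivAt (fun s => Real.exp (a * s) * y s) (-(Real.exp (a * s) * stepFun T N c s)) s := by
    rintro s ⟨hs, hs'⟩
    have hsT : s ∈ Ioo 0 T := ⟨hs.1, hs.2.trans_le ht.2⟩
    obtain ⟨n, hn⟩ := exists_mem_timeCell hT hN (Ioo_subset_Icc_self hsT) hs'
    have d1 := intervalIntegral.integral_hasDerivAt_right (intervalIntegrable_stepFun N c 0 s)
      (measurable_stepFun T N c).stronglyMeasurable.stronglyMeasurableAtFilter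
      (continuousAt_stepFun hT c hn)
    have d2 := intervalIntegral.integral_hasDerivAt_right
      (hint.mono_set (by
        rw [uIcc_of_le hsT.1.le, uIcc_of_le hT.le]; exact Icc_subset_Icc_right hsT.2.le))
      (hyc'.stronglyMeasurableAtFilter isOpen_Ioo s hsT)
      (hyc'.continuousAt (isOpen_Ioo.mem_nhds hsT))
    have d3 : HasDerivAt y (-stepFun T N c s - a * y s) s :=
      (d1.neg.sub d2).congr_of_eventuallyEq (Filter.eventually_of_mem (isOpen_Ioo.mem_nhds hsT)
        fun r hr => hye r (Ioo_subset_Icc_self hr))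
    have d4 := (((hasDerivAt_id s).const_mul a).exp).mul d3
    refine d4.congr_deriv ?_
    simp only [id]; ring
  have hi : ∀ b, IntervalIntegrable (fun s => b * (Real.exp (a * s) * stepFun T N c s)) volume 0 t :=
    fun b => ((intervalIntegrable_stepFun N c 0 t).continuousOn_mul
      (by fun_prop : Continuous fun s => Real.exp (a * s)).continuousOn).const_mul b
  have hF := integral_eq_of_hasDerivAt_off_countable_of_le
    (fun s => Real.exp (a * s) * y s) (fun s => -(Real.exp (a * s) * stepFun T N c s)) ht.1
    (timeNodes T N).countable_toSet
    (((by fun_prop : Continuous fun s => Real.exp (a * s)).continuousOn).mul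
      (hyc.mono (Icc_subset_Icc_right ht.2))) hder (by simpa using hi (-1))
  have hy0 : y 0 = 0 := by simpa using hy 0 ⟨le_rfl, hT.le⟩
  rw [intervalIntegral.integral_neg, hy0, mul_zero, sub_zero] at hF
  have e : ∀ s, Real.exp (-(a * (t - s))) * stepFun T N c s =
      Real.exp (-(a * t)) * (Real.exp (a * s) * stepFun T N c s) := fun s => by
    rw [← mul_assoc, ← Real.exp_add]; congr 2; ring
  simp only [e]
  rw [intervalIntegral.integral_const_mul, ← mul_neg, hF, ← mul_assoc, ← Real.exp_add]
  simp

lemma integral_regNoise_mul {Ω : Type*} (T : ℝ) (N J : ℕ) (R : Fin N → Fin (J + 1) → Ω → ℝ)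
    (ω : Ω) {g : ℝ → ℝ} (hg : Continuous g) (s : ℝ) :
    ∫ x in D, regNoise T N J R s x ω * g x =
      stepFun T N (fun n => (T / N)⁻¹ * ∑ m, hatCoef J g m * R n m ω) s := by
  have i0 : ∀ n l, Integrable (fun x => (timeCell T N n).indicator (fun _ => (T / N)⁻¹ *
      ∑ m, (gram J)⁻¹ l m * R n m ω) s * (hat J l x * g x)) (volume.restrict D) := fun n l =>
    ((memLp_hat J l).integrable_mul (memLp_D_of_continuous hg 2)).const_mul _
  have e : ∀ x, regNoise T N J R s x ω * g x = ∑ n, ∑ l, (timeCell T N n).indicator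
      (fun _ => (T / N)⁻¹ * ∑ m, (gram J)⁻¹ l m * R n m ω) s * (hat J l x * g x) := fun x => by
    rw [regNoise, mul_assoc, Finset.sum_mul, Finset.mul_sum]
    refine Finset.sum_congr rfl fun n _ => ?_
    by_cases h : s ∈ timeCell T N n
    · simp only [indicator_of_mem h, Finset.sum_mul, Finset.mul_sum]
      refine Finset.sum_congr rfl fun l _ => Finset.sum_congr rfl fun m _ => by ring
    · simp [h]
  simp only [e]
  rw [integral_finsetSum _ fun n _ => integrable_finsetSum _ fun l _ => i0 n l, stepFun]
  refine Finset.sum_congr rfl fun n _ => ?_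
  rw [integral_finsetSum _ fun l _ => i0 n l]
  simp only [integral_const_mul]
  by_cases h : s ∈ timeCell T N n
  · simp only [indicator_of_mem h, hatCoef, Finset.sum_mul, Finset.mul_sum]
    rw [Finset.sum_comm]
    refine Finset.sum_congr rfl fun l _ => Finset.sum_congr rfl fun m _ => by ring
  · simp [h]

/-- The `k`-th Fourier coefficient of the solution of the regularized problem, in terms of the
noise coefficients. -/
noncomputable def regCoef {Ω : Type*} (T μ : ℝ) (N J : ℕ) (R : Fin N → Fin (J + 1) → Ω → ℝ)
    (t : ℝ) (k : ℕ) (ω : Ω) : ℝ :=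
  ∑ q : Fin N × Fin (J + 1),
    -(cellMean T N (profile (rate μ k) t) q.1 * hatCoef J (deriv (eps k)) q.2) * R q.1 q.2 ω

lemma integral_mul_eps_eq_regCoef {Ω : Type*} {T : ℝ} (hT : 0 < T) {μ : ℝ} {N J : ℕ} (hN : 1 ≤ N)
    {R : Fin N → Fin (J + 1) → Ω → ℝ} {ω : Ω} {v : ℝ → ℝ → ℝ}
    (hv : IsWeakSolution T μ (fun t x => regNoise T N J R t x ω) v) {t : ℝ} (ht : t ∈ Icc 0 T)
    (k : ℕ) : ∫ x in D, v t x * eps k x = regCoef T μ N J R t k ω := by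
  obtain ⟨htest, h2, h4⟩ := isTestFunction_eps k
  set c : Fin N → ℝ := fun n => (T / N)⁻¹ * ∑ m, hatCoef J (deriv (eps k)) m * R n m ω with hc
  have e1 : ∀ s, ∫ x in D, v s x * (iteratedDeriv 4 (eps k) x + μ * iteratedDeriv 2 (eps k) x) =
      rate μ k * ∫ x in D, v s x * eps k x := fun s => by
    rw [← integral_const_mul]
    refine integral_congr_ae (Filter.Eventually.of_forall fun x => ?_)
    simp only [h2, h4, rate]; ring
  have hint := hv.integrable _ htest
  have hweak := hv.weak_eq _ htest
  simp only [e1, integral_regNoise_mul T N J R ω (continuous_deriv_eps k)] at hint hweak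
  have hd := duhamel hT hN c (y := fun s => ∫ x in D, v s x * eps k x) hint hweak ht
  refine hd.trans ?_
  rw [← integral_profile_mul ht]
  have hp : IntegrableOn (profile (rate μ k) t) (Icc 0 T) :=
    (memLp_profile (rate μ k) T t).integrable (by norm_num)
  have e2 : ∀ s, profile (rate μ k) t s * stepFun T N c s =
      ∑ n, (timeCell T N n).indicator (fun s => profile (rate μ k) t s * c n) s := fun s => by
    rw [stepFun, Finset.mul_sum]
    refine Finset.sum_congr rfl fun n _ => ?_
    by_cases h : s ∈ timeCell T N n <;> simp [h]
  simp only [e2]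
  rw [integral_finsetSum _ fun n _ =>
    Integrable.indicator (Integrable.mul_const hp _) (measurableSet_timeCell T N n), regCoef,
    Fintype.sum_prod_type, ← Finset.sum_neg_distrib]
  refine Finset.sum_congr rfl fun n _ => ?_
  rw [integral_indicator (measurableSet_timeCell T N n),
    Measure.restrict_restrict (measurableSet_timeCell T N n),
    inter_eq_left.2 (timeCell_subset hT n), integral_mul_const, hc]
  simp only [cellMean, Finset.mul_sum, ← Finset.sum_neg_distrib]
  exact Finset.sum_congr rfl fun m _ => by ring

/-- The Fourier coefficients of the solution of the regularized problem are stochastic integrals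
of the projected modes. -/
lemma isStochIntegral_regCoef {Ω : Type*} [MeasurableSpace Ω] {P : Measure Ω} {T μ : ℝ}
    {W : Set (ℝ × ℝ) → Ω → ℝ} (hW : IsWhiteNoise P (spaceTime T) W) {N J : ℕ}
    {R : Fin N → Fin (J + 1) → Ω → ℝ} (hR : IsNoiseCoefficients P T W N J R) (t : ℝ) (k : ℕ) :
    IsStochIntegral P (spaceTime T) W (fun z => -modeProj T μ N J t k z)
      (regCoef T μ N J R t k) := by
  have h := IsStochIntegral.sum hW (Finset.univ : Finset (Fin N × Fin (J + 1)))
    (fun q => -(cellMean T N (profile (rate μ k) t) q.1 * hatCoef J (deriv (eps k)) q.2))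
    (fun q => hR q.1 q.2)
  suffices e : (fun z => -modeProj T μ N J t k z) = fun z => ∑ q : Fin N × Fin (J + 1),
      -(cellMean T N (profile (rate μ k) t) q.1 * hatCoef J (deriv (eps k)) q.2) *
        (timeCell T N q.1).indicator (fun _ => hat J q.2 z.2) z.1 by
    rw [e]; exact h
  funext z
  rw [modeProj, stepFun, hatProj, Finset.sum_mul_sum, Fintype.sum_prod_type,
    ← Finset.sum_neg_distrib]
  refine Finset.sum_congr rfl fun n _ => ?_
  rw [← Finset.sum_neg_distrib]
  refine Finset.sum_congr rfl fun m _ => ?_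
  by_cases h : z.1 ∈ timeCell T N n
  · simp only [indicator_of_mem h]; ring
  · simp [h]

/-! ### The kernel of the mild solution and its partial sums -/

lemma summable_Psi (μ : ℝ) {r : ℝ} (hr : 0 < r) (x y : ℝ) :
    Summable fun j : ℕ => Real.exp (-(lam (j + 1) ^ 2 * (lam (j + 1) ^ 2 - μ) * r)) *
      eps (j + 1) x * deriv (eps (j + 1)) y := by
  have hs : Summable fun j : ℕ => 4 / r * (1 / ((j : ℝ) + 1) ^ 2) := by
    have := (summable_nat_add_iff 1).2 (Real.summable_one_div_nat_pow.2 one_lt_two)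
    push_cast at this
    exact this.mul_left _
  refine hs.of_norm_bounded_eventually_nat ?_
  filter_upwards [Filter.eventually_ge_atTop ⌈2 * μ⌉₊] with j hj
  have hj0 : (0 : ℝ) ≤ j := by positivity
  have hjμ : 2 * μ ≤ j := Nat.ceil_le.1 hj
  have h1 := succ_le_lam j
  set l := lam (j + 1) with hl
  have hl1 : 1 ≤ l := by linarith
  have hl0 : 0 < l := by linarith
  have hlμ : 2 * μ ≤ l ^ 2 := by nlinarith
  have hX : l ^ 4 / 2 * r ≤ l ^ 2 * (l ^ 2 - μ) * r := by
    gcongr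
    nlinarith [mul_nonneg (sq_nonneg l) (sub_nonneg.2 hlμ)]
  have hX0 : 0 < l ^ 4 / 2 * r := by positivity
  have hexp : Real.exp (-(l ^ 2 * (l ^ 2 - μ) * r)) ≤ 2 / (l ^ 4 * r) := by
    calc _ ≤ Real.exp (-(l ^ 4 / 2 * r)) := Real.exp_le_exp.2 (neg_le_neg hX)
      _ = (Real.exp (l ^ 4 / 2 * r))⁻¹ := Real.exp_neg _
      _ ≤ (l ^ 4 / 2 * r)⁻¹ := by
          gcongr
          linarith [Real.add_one_le_exp (l ^ 4 / 2 * r)]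
      _ = _ := by field_simp
  rw [Real.norm_eq_abs, abs_mul, abs_mul, Real.abs_exp]
  calc _ ≤ 2 / (l ^ 4 * r) * √2 * (√2 * l) := by
        gcongr
        · exact abs_eps_le _ _
        · exact abs_deriv_eps_le _ _
    _ = 4 / r * (1 / l ^ 3) := by
        have := Real.mul_self_sqrt (zero_le_two (α := ℝ))
        field_simp
        linear_combination 2 * this
    _ ≤ 4 / r * (1 / ((j : ℝ) + 1) ^ 2) := by
        gcongr
        calc ((j : ℝ) + 1) ^ 2 ≤ l ^ 2 := by gcongr
          _ ≤ l ^ 3 := pow_le_pow_right₀ hl1 (by norm_num)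

/-- The integrand `(s,y) ↦ 1_{(0,t)}(s) Ψ(t-s;x,y)` of the mild solution. -/
noncomputable def mildKernel (μ t x : ℝ) (z : ℝ × ℝ) : ℝ :=
  (Ioo 0 t).indicator (fun s => Psi μ (t - s) x z.2) z.1

lemma tendsto_mildKernel (μ t x : ℝ) (z : ℝ × ℝ) :
    Filter.Tendsto (fun M => ∑ j ∈ Finset.range M, -modeFun μ t (j + 1) z * eps (j + 1) x)
      Filter.atTop (nhds (mildKernel μ t x z)) := by
  by_cases h : z.1 ∈ Ioo 0 t
  · have hs := (summable_Psi μ (sub_pos.2 h.2) x z.2).hasSum.neg.tendsto_sum_nat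
    simp only [mildKernel, indicator_of_mem h, Psi]
    refine hs.congr fun M => Finset.sum_congr rfl fun j _ => ?_
    simp only [modeFun, profile, indicator_of_mem h, rate]
    ring
  · simp [mildKernel, modeFun, profile, h]

lemma measurable_modeFun (μ t : ℝ) (k : ℕ) : Measurable (modeFun μ t k) :=
  ((measurable_profile _ t).comp measurable_fst).mul
    ((continuous_deriv_eps k).measurable.comp measurable_snd)

lemma measurable_modeProj (T μ : ℝ) (N J : ℕ) (t : ℝ) (k : ℕ) :
    Measurable (modeProj T μ N J t k) :=
  ((measurable_stepFun T N _).comp measurable_fst).mul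
    ((continuous_hatProj J _).measurable.comp measurable_snd)

/-- Parseval's identity in `x` for a finite sine sum whose coefficients depend on a parameter. -/
lemma lintegral_sum_mul_eps_sq {E : Type*} [MeasurableSpace E] {ν : Measure E} [SFinite ν]
    {c : ℕ → E → ℝ} (hc : ∀ j, Measurable (c j)) (hc2 : ∀ j, MemLp (c j) 2 ν) (M : ℕ) :
    ∫⁻ x in D, ∫⁻ z, ‖∑ j ∈ Finset.range M, c j z * eps (j + 1) x‖ₑ ^ 2 ∂ν =
      ENNReal.ofReal (∑ j ∈ Finset.range M, ∫ z, c j z ^ 2 ∂ν) := by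
  have hm : Measurable fun p : ℝ × E => ∑ j ∈ Finset.range M, c j p.2 * eps (j + 1) p.1 :=
    Finset.measurable_sum _ fun j _ => ((hc j).comp measurable_snd).mul
      ((continuous_eps _).measurable.comp measurable_fst)
  rw [lintegral_lintegral_swap (hm.enorm.pow_const 2).aemeasurable,
    ← integral_finsetSum _ fun j _ => (hc2 j).integrable_sq,
    ofReal_integral_eq_lintegral_ofReal (integrable_finsetSum _ fun j _ => (hc2 j).integrable_sq)
      (Filter.Eventually.of_forall fun z => Finset.sum_nonneg fun j _ => sq_nonneg _)]
  refine lintegral_congr fun z => ?_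
  rw [lintegral_enorm_sq_eq_ofReal (memLp_finsetSum _ fun j _ => (memLp_eps (j + 1)).const_mul _),
    integral_sum_eps_sq M fun j => c j z]

/-- The distance between the kernel of the mild solution and the one of the truncated Fourier series
of the solution of the regularized problem. By Fatou's lemma, it suffices to bound the partial sums
of the kernel of the mild solution, to which Parseval's identity applies. -/
lemma lintegral_mildKernel_sub_le {T : ℝ} (hT : 0 < T) (μ : ℝ) {t : ℝ} (ht : t ∈ Icc 0 T)
    {N J : ℕ} (hN : 1 ≤ N) (hJ : 1 ≤ J) {K : ℕ} (hK : 1 ≤ K) :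
    ∫⁻ x in D, ∫⁻ z, ‖mildKernel μ t x z
        + ∑ j ∈ Finset.range K, eps (j + 1) x * modeProj T μ N J t (j + 1) z‖ₑ ^ 2 ∂spaceTime T ≤
      ENNReal.ofReal (90 * modeConst T μ * (1 / (J : ℝ) + (T / N) ^ (1 / 4 : ℝ))
        + energyConst T μ * (1 / K)) := by
  let c : ℕ → ℝ × ℝ → ℝ := fun j z =>
    -modeFun μ t (j + 1) z + if j < K then modeProj T μ N J t (j + 1) z else 0
  have hc : ∀ j, Measurable (c j) := fun j => by
    refine (measurable_modeFun μ t (j + 1)).neg.add ?_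
    split_ifs
    · exact measurable_modeProj T μ N J t (j + 1)
    · exact measurable_const
  have hc2 : ∀ j, MemLp (c j) 2 (spaceTime T) := fun j => by
    refine (memLp_modeFun T μ t (j + 1)).neg.add ?_
    split_ifs
    · exact memLp_modeProj T μ N J t (j + 1)
    · exact MemLp.zero
  let S : ℕ → ℝ × (ℝ × ℝ) → ℝ := fun M p => ∑ j ∈ Finset.range M, c j p.2 * eps (j + 1) p.1
  have hS : ∀ M, Measurable (S M) := fun M =>
    Finset.measurable_sum _ fun j _ => ((hc j).comp measurable_snd).mul
      ((continuous_eps _).measurable.comp measurable_fst)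
  have hlim : ∀ x z, Filter.Tendsto (fun M => S M (x, z)) Filter.atTop (nhds (mildKernel μ t x z
      + ∑ j ∈ Finset.range K, eps (j + 1) x * modeProj T μ N J t (j + 1) z)) := by
    intro x z
    refine ((tendsto_mildKernel μ t x z).add_const _).congr' ?_
    filter_upwards [Filter.eventually_ge_atTop K] with M hM
    simp only [S, c, add_mul, Finset.sum_add_distrib, ite_mul, zero_mul]
    congr 1
    rw [← Finset.sum_filter]
    refine Finset.sum_congr ?_ fun j _ => mul_comm _ _
    ext j
    simp only [Finset.mem_range, Finset.mem_filter]
    omega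
  calc _ = ∫⁻ x in D, ∫⁻ z, Filter.liminf (fun M => ‖S M (x, z)‖ₑ ^ 2) Filter.atTop
          ∂spaceTime T := by
        refine lintegral_congr fun x => lintegral_congr fun z => ?_
        exact (((ENNReal.continuous_pow 2).comp continuous_enorm).tendsto _ |>.comp
          (hlim x z)).liminf_eq.symm
    _ ≤ ∫⁻ x in D, Filter.liminf (fun M => ∫⁻ z, ‖S M (x, z)‖ₑ ^ 2 ∂spaceTime T) Filter.atTop :=
        lintegral_mono fun x => lintegral_liminf_le fun M =>
          ((hS M).comp measurable_prodMk_left).enorm.pow_const 2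
    _ ≤ Filter.liminf (fun M => ∫⁻ x in D, ∫⁻ z, ‖S M (x, z)‖ₑ ^ 2 ∂spaceTime T) Filter.atTop :=
        lintegral_liminf_le fun M => Measurable.lintegral_prod_right' ((hS M).enorm.pow_const 2)
    _ ≤ _ := by
        refine Filter.liminf_le_of_frequently_le' (Filter.Eventually.frequently ?_)
        filter_upwards [Filter.eventually_ge_atTop K] with M hM
        refine (lintegral_sum_mul_eps_sq hc hc2 M).trans_le (ENNReal.ofReal_le_ofReal ?_)
        rw [← Finset.sum_range_add_sum_Ico _ hM]
        refine add_le_add ?_ ?_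
        · refine le_trans (Finset.sum_le_sum fun j hj => le_of_eq ?_)
            (sum_integral_modeFun_sub_modeProj_sq_le hT μ ht hN hJ K)
          refine integral_congr_ae (Filter.Eventually.of_forall fun z => ?_)
          simp only [c, if_pos (Finset.mem_range.1 hj)]
          ring
        · calc _ ≤ ∑ j ∈ Finset.Ico K M, energyConst T μ * (1 / ((j : ℝ) + 1) ^ 2) := by
                refine Finset.sum_le_sum fun j hj => ?_
                refine le_trans (le_of_eq ?_) (integral_modeFun_sq_le hT.le μ ht j)
                refine integral_congr_ae (Filter.Eventually.of_forall fun z => ?_)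
                simp [c, not_lt.2 (Finset.mem_Ico.1 hj).1]
            _ ≤ _ := by
                rw [← Finset.mul_sum]
                exact mul_le_mul_of_nonneg_left (sum_Ico_one_div_sq_le hK M)
                  (zero_le_one.trans (one_le_energyConst hT.le μ))

/-! ### The error estimate -/

section Error

/-- For almost every path, the truncated Fourier series of the solution of the regularized problem
converge to it. -/
lemma eLpNorm_sub_sq_le_liminf {Ω : Type*} {T μ : ℝ} {u v : ℝ → ℝ → Ω → ℝ} {N J : ℕ}
    {R : Fin N → Fin (J + 1) → Ω → ℝ} (hT : 0 < T) (hN : 1 ≤ N) {t : ℝ} (ht : t ∈ Icc 0 T) {ω : Ω}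
    (hu : AEStronglyMeasurable (fun x => u t x ω) (volume.restrict D))
    (hv : IsWeakSolution T μ (fun t x => regNoise T N J R t x ω) (fun t x => v t x ω)) :
    eLpNorm (fun x => u t x ω - v t x ω) 2 (volume.restrict D) ^ 2 ≤
      Filter.liminf (fun K => ∫⁻ x in D, ‖u t x ω - ∑ j ∈ Finset.range K,
        regCoef T μ N J R t (j + 1) ω * eps (j + 1) x‖ₑ ^ 2) Filter.atTop := by
  have hd := tendsto_eLpNorm_sine_expansion (hv.memLp t ht)
  simp only [integral_mul_eps_eq_regCoef hT hN hv ht] at hd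
  set a := eLpNorm (fun x => u t x ω - v t x ω) 2 (volume.restrict D)
  have hlim := ((ENNReal.continuous_pow 2).tendsto _).comp
    (ENNReal.Tendsto.sub (tendsto_const_nhds (x := a)) hd (Or.inr ENNReal.zero_ne_top))
  rw [tsub_zero] at hlim
  rw [← hlim.liminf_eq]
  refine Filter.liminf_le_liminf (Filter.Eventually.of_forall fun K => ?_)
  have hsum : AEStronglyMeasurable (fun x => ∑ j ∈ Finset.range K,
      regCoef T μ N J R t (j + 1) ω * eps (j + 1) x) (volume.restrict D) :=
    Finset.aestronglyMeasurable_fun_sum _ fun j _ =>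
      (continuous_eps _).aestronglyMeasurable.const_mul _
  rw [← eLpNorm_two_sq]
  refine pow_le_pow_left₀ zero_le (tsub_le_iff_right.2 ?_) 2
  refine le_trans (le_of_eq ?_)
    (eLpNorm_add_le (hu.sub hsum) (hsum.sub (hv.memLp t ht).1) one_le_two)
  simp only [a]
  congr 1
  funext x
  simp

variable {Ω : Type*} [MeasurableSpace Ω] {P : Measure Ω} {T μ : ℝ}
  {W : Set (ℝ × ℝ) → Ω → ℝ} {u v : ℝ → ℝ → Ω → ℝ} {N J : ℕ} {R : Fin N → Fin (J + 1) → Ω → ℝ}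

lemma aestronglyMeasurable_sub_truncation (hW : IsWhiteNoise P (spaceTime T) W)
    (hu : IsMildSolution P T μ W u) (hR : IsNoiseCoefficients P T W N J R) {t : ℝ}
    (ht : t ∈ Icc 0 T) (K : ℕ) :
    AEStronglyMeasurable (fun p : ℝ × Ω => u t p.1 p.2 - ∑ j ∈ Finset.range K,
      regCoef T μ N J R t (j + 1) p.2 * eps (j + 1) p.1) ((volume.restrict D).prod P) := by
  refine (hu.measurable t ht).sub ?_
  refine Finset.aestronglyMeasurable_fun_sum _ fun j _ => ?_
  exact (isStochIntegral_regCoef hW hR t (j + 1)).2.1.1.comp_snd.mul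
    (continuous_eps _).aestronglyMeasurable.comp_fst

variable [SFinite P]

lemma lintegral_sub_truncation_le (hT : 0 < T) (hW : IsWhiteNoise P (spaceTime T) W)
    (hu : IsMildSolution P T μ W u) (hN : 1 ≤ N) (hJ : 1 ≤ J)
    (hR : IsNoiseCoefficients P T W N J R) {t : ℝ} (ht : t ∈ Icc 0 T) {K : ℕ} (hK : 1 ≤ K) :
    ∫⁻ ω, (∫⁻ x in D, ‖u t x ω - ∑ j ∈ Finset.range K,
        regCoef T μ N J R t (j + 1) ω * eps (j + 1) x‖ₑ ^ 2) ∂P ≤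
      ENNReal.ofReal (90 * modeConst T μ * (1 / (J : ℝ) + (T / N) ^ (1 / 4 : ℝ))
        + energyConst T μ * (1 / K)) := by
  rw [← lintegral_lintegral_swap (f := fun x ω => ‖u t x ω - ∑ j ∈ Finset.range K,
    regCoef T μ N J R t (j + 1) ω * eps (j + 1) x‖ₑ ^ 2)
    ((aestronglyMeasurable_sub_truncation hW hu hR ht K).enorm.pow_const 2)]
  refine le_trans (lintegral_mono_ae ?_) (lintegral_mildKernel_sub_le hT μ ht hN hJ hK)
  filter_upwards [ae_restrict_mem (measurableSet_Ioo : MeasurableSet D)] with x hx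
  have h1 := IsStochIntegral.sum hW (Finset.range K) (fun j => eps (j + 1) x)
    fun j => isStochIntegral_regCoef (μ := μ) hW hR t (j + 1)
  have h2 := ((hu.eq_integral t ht x hx).add_const_mul hW (-1) h1).eLpNorm_le hW
  have h3 := pow_le_pow_left₀ zero_le h2 2
  simp only [eLpNorm_two_sq, neg_one_mul, mul_neg, Finset.sum_neg_distrib, neg_neg,
    ← sub_eq_add_neg] at h3
  simp only [mul_comm (regCoef _ _ _ _ _ _ _ _)]
  exact h3

lemma lintegral_eLpNorm_sub_sq_le (hT : 0 < T) (hW : IsWhiteNoise P (spaceTime T) W)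
    (hu : IsMildSolution P T μ W u) (hN : 1 ≤ N) (hJ : 1 ≤ J)
    (hR : IsNoiseCoefficients P T W N J R) (hv : IsRegularizedSolution P T μ N J R v) {t : ℝ}
    (ht : t ∈ Icc 0 T) :
    ∫⁻ ω, eLpNorm (fun x => u t x ω - v t x ω) 2 (volume.restrict D) ^ 2 ∂P ≤
      ENNReal.ofReal (90 * modeConst T μ * (1 / (J : ℝ) + (T / N) ^ (1 / 4 : ℝ))) := by
  calc _ ≤ ∫⁻ ω, Filter.liminf (fun K => ∫⁻ x in D, ‖u t x ω - ∑ j ∈ Finset.range K,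
        regCoef T μ N J R t (j + 1) ω * eps (j + 1) x‖ₑ ^ 2) Filter.atTop ∂P := by
        refine lintegral_mono_ae ?_
        filter_upwards [hv.weak, (hu.measurable t ht).prod_swap.prodMk_left] with ω h1 h2
        exact eLpNorm_sub_sq_le_liminf hT hN ht h2 h1
    _ ≤ Filter.liminf (fun K => ∫⁻ ω, (∫⁻ x in D, ‖u t x ω - ∑ j ∈ Finset.range K,
        regCoef T μ N J R t (j + 1) ω * eps (j + 1) x‖ₑ ^ 2) ∂P) Filter.atTop :=
        lintegral_liminf_le' fun K => AEMeasurable.lintegral_prod_left'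
          (f := fun p : ℝ × Ω => ‖u t p.1 p.2 - ∑ j ∈ Finset.range K,
            regCoef T μ N J R t (j + 1) p.2 * eps (j + 1) p.1‖ₑ ^ 2)
          ((aestronglyMeasurable_sub_truncation hW hu hR ht K).enorm.pow_const 2)
    _ ≤ Filter.liminf (fun K : ℕ => ENNReal.ofReal
          (90 * modeConst T μ * (1 / (J : ℝ) + (T / N) ^ (1 / 4 : ℝ))
            + energyConst T μ * (1 / (K : ℝ)))) Filter.atTop := by
        refine Filter.liminf_le_liminf ?_
        filter_upwards [Filter.eventually_ge_atTop 1] with K hK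
        exact lintegral_sub_truncation_le hT hW hu hN hJ hR ht hK
    _ = _ := by
        refine Filter.Tendsto.liminf_eq (ENNReal.tendsto_ofReal ?_)
        simpa using ((tendsto_one_div_atTop_nhds_zero_nat (𝕜 := ℝ)).const_mul
          (energyConst T μ)).const_add
            (90 * modeConst T μ * (1 / (J : ℝ) + (T / N) ^ (1 / 4 : ℝ)))

lemma rmsError_le (hT : 0 < T) (hW : IsWhiteNoise P (spaceTime T) W)
    (hu : IsMildSolution P T μ W u) (hN : 1 ≤ N) (hJ : 1 ≤ J)
    (hR : IsNoiseCoefficients P T W N J R) (hv : IsRegularizedSolution P T μ N J R v) {t : ℝ}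
    (ht : t ∈ Icc 0 T) :
    rmsError P u v t ≤ ENNReal.ofReal
      (√(90 * modeConst T μ) * ((T / N) ^ (1 / 8 : ℝ) + (1 / (J : ℝ)) ^ (1 / 2 : ℝ))) := by
  have hM0 : 0 < modeConst T μ := by
    linarith [one_le_energyConst hT.le μ, energyConst_le_modeConst hT.le μ]
  have hΔ : 0 ≤ T / N := by positivity
  have hJ0 : 0 ≤ 1 / (J : ℝ) := by positivity
  refine (ENNReal.rpow_le_rpow (lintegral_eLpNorm_sub_sq_le hT hW hu hN hJ hR hv ht) (by norm_num)).trans ?_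
  rw [ENNReal.ofReal_rpow_of_nonneg (by positivity) (by norm_num)]
  refine ENNReal.ofReal_le_ofReal ?_
  rw [← Real.sqrt_eq_rpow, ← Real.sqrt_eq_rpow, Real.sqrt_mul (by positivity)]
  refine mul_le_mul_of_nonneg_left ?_ (Real.sqrt_nonneg _)
  rw [add_comm]
  refine (Real.sqrt_le_iff.2 ⟨by positivity, ?_⟩ : _ ≤ √((T / N) ^ (1 / 4 : ℝ)) + √(1 / (J : ℝ))).trans_eq ?_
  · have h1 := Real.sq_sqrt (show 0 ≤ (T / N) ^ (1 / 4 : ℝ) by positivity)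
    have h2 := Real.sq_sqrt hJ0
    have h3 : 0 ≤ √((T / N) ^ (1 / 4 : ℝ)) * √(1 / (J : ℝ)) := by positivity
    nlinarith
  rw [Real.sqrt_eq_rpow ((T / N) ^ (1 / 4 : ℝ)), ← Real.rpow_mul hΔ]
  norm_num

end Error

end CHC

theorem theorem3p1 (T : ℝ) (hT : 0 < T) (μ : ℝ) (κ : ℕ) (hκ : 1 ≤ κ)
    (hμ : ((κ : ℝ) - 1) ^ 2 * Real.pi ^ 2 ≤ μ) (hμ' : μ < (κ : ℝ) ^ 2 * Real.pi ^ 2) :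
    ∃ C : ℝ, 0 < C ∧
      ∀ (Ω : Type*) [MeasurableSpace Ω] (P : Measure Ω) [IsProbabilityMeasure P]
        (W : Set (ℝ × ℝ) → Ω → ℝ), CHC.IsWhiteNoise P (CHC.spaceTime T) W →
      ∀ u : ℝ → ℝ → Ω → ℝ, CHC.IsMildSolution P T μ W u →
      ∀ (N J : ℕ), 1 ≤ N → 1 ≤ J →
      ∀ R : Fin N → Fin (J + 1) → Ω → ℝ, CHC.IsNoiseCoefficients P T W N J R →
      ∀ v : ℝ → ℝ → Ω → ℝ, CHC.IsRegularizedSolution P T μ N J R v →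
      ∀ ε : ℝ, 0 < ε → ε ≤ 1 / 2 →
      ∀ t ∈ Icc 0 T,
        CHC.rmsError P u v t ≤
          ENNReal.ofReal (C * (CHC.omega0 (T / N) * (T / N) ^ (1 / 8 : ℝ)
            + ε ^ (-(1 / 2) : ℝ) * (1 / (J : ℝ)) ^ (1 / 2 - ε))) := by
  have hM0 : 0 < CHC.modeConst T μ := by
    linarith [CHC.one_le_energyConst hT.le μ, CHC.energyConst_le_modeConst hT.le μ]
  refine ⟨√(90 * CHC.modeConst T μ), by positivity, ?_⟩
  intro Ω _ P _ W hW u hu N J hN hJ R hR v hv ε hε hε2 t ht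
  refine (CHC.rmsError_le hT hW hu hN hJ hR hv ht).trans (ENNReal.ofReal_le_ofReal ?_)
  have hJ' : (1 : ℝ) ≤ J := by exact_mod_cast hJ
  -- `ω₀ ≥ 1` and `ε ^ (-1/2) ≥ 1`, and `Δx ≤ 1`, so the bound `C (Δt^{1/8} + Δx^{1/2})` suffices.
  have hω : 1 ≤ CHC.omega0 (T / N) := by
    refine Real.one_le_sqrt.2 ?_
    have : 0 ≤ (T / N : ℝ) ^ (3 / 4 : ℝ) := by positivity
    linarith
  have hε1 : 1 ≤ ε ^ (-(1 / 2) : ℝ) :=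
    Real.one_le_rpow_of_pos_of_le_one_of_nonpos hε (by linarith) (by norm_num)
  have hJε : (1 / (J : ℝ)) ^ (1 / 2 : ℝ) ≤ (1 / (J : ℝ)) ^ (1 / 2 - ε) :=
    Real.rpow_le_rpow_of_exponent_ge (by positivity) ((div_le_one (by linarith)).2 hJ')
      (by linarith)
  refine mul_le_mul_of_nonneg_left (add_le_add ?_ ?_) (Real.sqrt_nonneg _)
  · exact le_mul_of_one_le_left (by positivity) hω
  · exact hJε.trans (le_mul_of_one_le_left (by positivity) hε1)
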